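/- Let $M$ be a smooth finite-dimensional manifold (Hausdorff, without boundary), let $n\ge 0$, and let $\mathcal G_n$ be the constant sheaf on $M$ with group $GL(n,\mathbb R)$, whose sections over an open set are the locally constant $GL(n,\mathbb R)$-valued functions. For an open cover $\mathcal U=\{U_\alpha\}_{\alpha\in A}$ of $M$, a $1$-cocycle is a family $t=(t_{\alpha\beta})$ of sections $t_{\alpha\beta}\in\mathcal G_n(U_\alpha\cap U_\beta)$ with $t_{\alpha\gamma}^{-1}t_{\alpha\beta}t_{\beta\gamma}=1$ on $U_\alpha\cap U_\beta\cap U_\gamma$. Two cocycles $t,t'$ are cohomologous if $t'_{\alpha\beta}=b_\alpha^{-1}t_{\alpha\beta}b_\beta$ for some sections $b_\alpha\in\mathcal G_n(U_\alpha)$. Let $\check H^1(\mathcal U,\mathcal G_n)$ be the set of classes, and let $H^1(M,\mathcal G_n)=\varinjlim_{\mathcal U}\check H^1(\mathcal U,\mathcal G_n)$ be the direct limit over refinement of covers. Let $\mathcal E_n$ be the set of isomorphism classes of pairs $(E,\nabla)$, where $E\to M$ is a smooth real vector bundle of rank $n$ and $\nabla$ is a smooth connection on $E$ with zero curvature; an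 isomorphism is a smooth vector bundle isomorphism over $\mathrm{id}_M$ that carries one connection to the other. Then there are maps $\Theta:\mathcal E_n\to H^1(M,\mathcal G_n)$ and $\Psi:H^1(M,\mathcal G_n)\to\mathcal E_n$ such that: (i) For every such $(E,\nabla)$ there is an open cover $\{U_\alpha\}$ of $M$ with frames $(h_{\alpha 1},\dots,h_{\alpha n})$ of parallel sections of $E$ over $U_\alpha$. For every such cover and every such choice of frames there is a $1$-cocycle $t$ with values in $\mathcal G_n$ such that $h_{\alpha i}=\sum_j (t_{\alpha\beta})_{ij}h_{\beta j}$ on $U_\alpha\cap U_\beta$, and $\Theta([E,\nabla])=[t]$. (ii) For every open cover $\{U_\alpha\}$ of $M$ and every $1$-cocycle $t$ of it with values in $\mathcal G_n$, let $E_t$ be the vector bundle glued from the products $U_\alpha\times\mathbb R^n$ with the locally constant transition functions $t_{\alpha\beta}$; thus its canonical local frames $e_{\alpha i}$ satisfy $e_{\alpha i}=\sum_j (t_{\alpha\beta})_{ij}e_{\beta j}$ on $U_\alpha\cap U_\beta$. Then $E_t$ carries a flat connection $\nabla_t$ for which all $e_{\alpha i}$ are parallel, and $\Psi([t])=[E_t,\nabla_t]$.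 (iii) $\Theta(\Psi(\theta))=\theta$ for all $\theta\in H^1(M,\mathcal G_n)$. (iv) $\Psi(\Theta(\xi))=\xi$ for all $\xi\in\mathcal E_n$. In particular, $\Theta$ is a bijection from $\mathcal E_n$ onto $H^1(M,\mathcal G_n)$ with inverse $\Psi$. -/

import Mathlib

open scoped Manifold ContDiff Topology
open TopologicalSpace (Opens)

universe u v w

/-! ### Nonabelian Čech cohomology of a constant sheaf of groups -/

namespace Cech

/-- An open cover `{U_α : α ∈ A}` of `X`, indexed by a type in the universe of `X`. -/
structure OpenCover (X : Type u) [TopologicalSpace X] : Type (u + 1) where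
  Index : Type u
  set : Index → Opens X
  covers : ∀ x, ∃ α, x ∈ set α

variable {X : Type u} [TopologicalSpace X] (G : Type v) [Group G]

/-- Sections over the open set `W` of the constant sheaf `G`: locally constant maps `W → G`. -/
abbrev Sections (W : Opens X) : Type (max u v) := LocallyConstant W G

variable {G}

/-- Restriction of sections of the constant sheaf. -/
def res {V W : Opens X} (h : V ≤ W) (s : Sections G W) : Sections G V :=
  s.comap ⟨Set.inclusion h, continuous_inclusion h⟩

variable (G)

/-- Čech `0`-cochains `(b_α)`, with `b_α` a section over `U_α`. -/
abbrev C0 (U : OpenCover X) := ∀ α : U.Index, Sections G (U.set α)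

/-- Čech `1`-cochains `(a_αβ)`, with `a_αβ` a section over `U_α ∩ U_β`. -/
abbrev C1 (U : OpenCover X) := ∀ α β : U.Index, Sections G (U.set α ⊓ U.set β)

/-- Čech `2`-cochains. -/
abbrev C2 (U : OpenCover X) := ∀ α β γ : U.Index, Sections G (U.set α ⊓ U.set β ⊓ U.set γ)

variable {G}

/-- The coboundary `(δ¹ a)_αβγ = a_αγ⁻¹ a_αβ a_βγ`. -/
def d1 {U : OpenCover X} (a : C1 G U) : C2 G U := fun α β γ =>
  (res (le_inf (inf_le_left.trans inf_le_left) inf_le_right) (a α γ))⁻¹ *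
    res inf_le_left (a α β) *
    res (le_inf (inf_le_left.trans inf_le_right) inf_le_right) (a β γ)

variable (G) in
/-- Čech `1`-cocycles: the `1`-cochains `a` with `δ¹ a = 1`. -/
def Z1 (U : OpenCover X) := {a : C1 G U // d1 a = 1}

lemma d1_eq_one_iff {U : OpenCover X} (a : C1 G U) :
    d1 a = 1 ↔ ∀ (α β γ : U.Index) (x : X) (hα : x ∈ U.set α) (hβ : x ∈ U.set β)
      (hγ : x ∈ U.set γ),
      a α β ⟨x, hα, hβ⟩ * a β γ ⟨x, hβ, hγ⟩ = a α γ ⟨x, hα, hγ⟩ := by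
  constructor
  · intro h α β γ x hα hβ hγ
    have h2 := congrArg (fun s => s α β γ ⟨x, ⟨hα, hβ⟩, hγ⟩) h
    have h3 : (a α γ ⟨x, hα, hγ⟩)⁻¹ * a α β ⟨x, hα, hβ⟩ * a β γ ⟨x, hβ, hγ⟩ = 1 := h2
    rw [mul_assoc] at h3
    exact (inv_mul_eq_one.mp h3).symm
  · intro h
    funext α β γ
    ext ⟨x, ⟨hα, hβ⟩, hγ⟩
    change (a α γ ⟨x, hα, hγ⟩)⁻¹ * a α β ⟨x, hα, hβ⟩ * a β γ ⟨x, hβ, hγ⟩ = 1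
    rw [mul_assoc, h α β γ x hα hβ hγ, inv_mul_cancel]

/-- `a ∼ a'` iff `a'_αβ = b_α⁻¹ a_αβ b_β` for some `0`-cochain `b`. -/
def Cohomologous {U : OpenCover X} (a a' : Z1 G U) : Prop :=
  ∃ b : C0 G U, ∀ α β,
    a'.1 α β = (res inf_le_left (b α))⁻¹ * a.1 α β * res inf_le_right (b β)

lemma cohomologous_iff {U : OpenCover X} (a a' : Z1 G U) :
    Cohomologous a a' ↔ ∃ b : C0 G U, ∀ (α β : U.Index) (x : X) (hα : x ∈ U.set α)
      (hβ : x ∈ U.set β),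
      a'.1 α β ⟨x, hα, hβ⟩ = (b α ⟨x, hα⟩)⁻¹ * a.1 α β ⟨x, hα, hβ⟩ * b β ⟨x, hβ⟩ := by
  refine exists_congr fun b => ⟨fun h α β x hα hβ => ?_, fun h α β => ?_⟩
  · rw [h α β]; rfl
  · ext ⟨x, hα, hβ⟩
    exact h α β x hα hβ

lemma cohomologous_equivalence (U : OpenCover X) :
    Equivalence (Cohomologous (G := G) (U := U)) where
  refl a := (cohomologous_iff _ _).2 ⟨1, fun α β x hα hβ => by simp⟩
  symm {a a'} h := by
    obtain ⟨b, hb⟩ := (cohomologous_iff _ _).1 h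
    refine (cohomologous_iff _ _).2 ⟨fun α => (b α)⁻¹, fun α β x hα hβ => ?_⟩
    rw [hb α β x hα hβ]
    simp [mul_assoc]
  trans {a a' a''} h h' := by
    obtain ⟨b, hb⟩ := (cohomologous_iff _ _).1 h
    obtain ⟨c, hc⟩ := (cohomologous_iff _ _).1 h'
    refine (cohomologous_iff _ _).2 ⟨fun α => b α * c α, fun α β x hα hβ => ?_⟩
    rw [hc α β x hα hβ, hb α β x hα hβ]
    simp [mul_assoc]

instance cocycleSetoid (U : OpenCover X) : Setoid (Z1 G U) where
  r := Cohomologous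
  iseqv := cohomologous_equivalence U

variable (G) in
/-- The first cohomology set of the cover `U` with coefficients in the constant sheaf `G`. -/
abbrev H1Cover (U : OpenCover X) := Quotient (cocycleSetoid (G := G) U)

/-- Covers are preordered by refinement: `U ≤ V` iff `V` refines `U`. -/
instance : Preorder (OpenCover X) where
  le U V := ∃ ρ : V.Index → U.Index, ∀ α, V.set α ≤ U.set (ρ α)
  le_refl U := ⟨id, fun _ => le_rfl⟩
  le_trans U V W := by
    rintro ⟨ρ, hρ⟩ ⟨σ, hσ⟩
    exact ⟨ρ ∘ σ, fun α => (hσ α).trans (hρ (σ α))⟩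

lemma cover_le_def {U V : OpenCover X} :
    U ≤ V ↔ ∃ ρ : V.Index → U.Index, ∀ α, V.set α ≤ U.set (ρ α) := Iff.rfl

instance : IsDirectedOrder (OpenCover X) where
  directed U V :=
    ⟨{  Index := U.Index × V.Index
        set := fun p => U.set p.1 ⊓ V.set p.2
        covers := fun x => by
          obtain ⟨α, hα⟩ := U.covers x
          obtain ⟨β, hβ⟩ := V.covers x
          exact ⟨(α, β), hα, hβ⟩ },
      ⟨Prod.fst, fun _ => inf_le_left⟩, ⟨Prod.snd, fun _ => inf_le_right⟩⟩

/-- The image `â_αβ = a_ρ(α)ρ(β)` (restricted) of a cocycle under a refinement map `ρ`. -/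
def Z1.refine {U V : OpenCover X} (a : Z1 G U) (ρ : V.Index → U.Index)
    (hρ : ∀ α, V.set α ≤ U.set (ρ α)) : Z1 G V :=
  ⟨fun α β => res (inf_le_inf (hρ α) (hρ β)) (a.1 (ρ α) (ρ β)),
    (d1_eq_one_iff _).2 fun α β γ x hα hβ hγ =>
      (d1_eq_one_iff a.1).1 a.2 (ρ α) (ρ β) (ρ γ) x (hρ α hα) (hρ β hβ) (hρ γ hγ)⟩

/-- Refinement respects cohomology and, up to cohomology, does not depend on the map `ρ`. -/
lemma Z1.refine_cohomologous {U V : OpenCover X} {a a' : Z1 G U} (h : Cohomologous a a')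
    (ρ σ : V.Index → U.Index) (hρ : ∀ α, V.set α ≤ U.set (ρ α))
    (hσ : ∀ α, V.set α ≤ U.set (σ α)) :
    Cohomologous (a.refine ρ hρ) (a'.refine σ hσ) := by
  obtain ⟨b, hb⟩ := (cohomologous_iff _ _).1 h
  refine (cohomologous_iff _ _).2
    ⟨fun α => res (hρ α) (b (ρ α)) *
      res (le_inf (hρ α) (hσ α)) (a'.1 (ρ α) (σ α)), fun α β x hα hβ => ?_⟩
  change a'.1 (σ α) (σ β) ⟨x, hσ α hα, hσ β hβ⟩ =
    (b (ρ α) ⟨x, hρ α hα⟩ * a'.1 (ρ α) (σ α) ⟨x, hρ α hα, hσ α hα⟩)⁻¹ *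
      a.1 (ρ α) (ρ β) ⟨x, hρ α hα, hρ β hβ⟩ *
      (b (ρ β) ⟨x, hρ β hβ⟩ * a'.1 (ρ β) (σ β) ⟨x, hρ β hβ, hσ β hβ⟩)
  have h1 := hb (ρ α) (ρ β) x (hρ α hα) (hρ β hβ)
  have h2 := (d1_eq_one_iff a'.1).1 a'.2 (ρ α) (ρ β) (σ β) x (hρ α hα) (hρ β hβ) (hσ β hβ)
  have h3 := (d1_eq_one_iff a'.1).1 a'.2 (ρ α) (σ α) (σ β) x (hρ α hα) (hσ α hα) (hσ β hβ)
  rw [h1] at h2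
  rw [mul_inv_rev, ← mul_right_inj (a'.1 (ρ α) (σ α) ⟨x, hρ α hα, hσ α hα⟩), h3, ← h2]
  simp only [mul_assoc, mul_inv_cancel_left]

/-- The map induced on cohomology sets by passing to a refinement. -/
noncomputable def H1Cover.map (U V : OpenCover X) (h : U ≤ V) : H1Cover G U → H1Cover G V :=
  Quotient.map (fun a => a.refine h.choose h.choose_spec)
    fun _ _ h' => Z1.refine_cohomologous h' _ _ _ _

/-- The induced map may be computed with any refinement map. -/
lemma H1Cover.map_mk {U V : OpenCover X} (h : U ≤ V) (a : Z1 G U) (ρ : V.Index → U.Index)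
    (hρ : ∀ α, V.set α ≤ U.set (ρ α)) :
    H1Cover.map U V h ⟦a⟧ = ⟦a.refine ρ hρ⟧ :=
  Quotient.sound (Z1.refine_cohomologous (cohomologous_equivalence U |>.refl a) _ _ _ _)

/-- A map between cohomology sets, regarded as a function (needed to state the direct limit). -/
instance (U V : OpenCover X) :
    FunLike (H1Cover G U → H1Cover G V) (H1Cover G U) (H1Cover G V) where
  coe f := f
  coe_injective _ _ h := h

instance : DirectedSystem (fun U : OpenCover X => H1Cover G U)
    (fun _ _ h => ⇑(H1Cover.map (G := G) _ _ h)) where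
  map_self U x := by
    induction x using Quotient.ind with
    | _ a => exact H1Cover.map_mk le_rfl a id (fun _ => le_rfl)
  map_map W V U hUV hVW x := by
    induction x using Quotient.ind with
    | _ a =>
      obtain ⟨ρ, hρ⟩ := hUV
      obtain ⟨σ, hσ⟩ := hVW
      change H1Cover.map _ _ _ (H1Cover.map _ _ _ ⟦a⟧) = H1Cover.map _ _ _ ⟦a⟧
      rw [H1Cover.map_mk _ a ρ hρ, H1Cover.map_mk _ _ σ hσ,
        H1Cover.map_mk _ a (ρ ∘ σ) (fun α => (hσ α).trans (hρ (σ α)))]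
      rfl

variable (X G) in
/-- The first cohomology set `H¹(X, G)` of the constant sheaf `G`: the direct limit of the
cohomology sets of the open covers of `X`, over refinement. -/
abbrev H1 := DirectLimit (fun U : OpenCover X => H1Cover G U) (fun U V h => H1Cover.map U V h)

/-- The class in `H¹(X, G)` of a cocycle of an open cover. -/
noncomputable def Z1.cls {U : OpenCover X} (a : Z1 G U) : H1 X G := ⟦⟨U, ⟦a⟧⟩⟧

end Cech

/-! ### Vector bundles with flat connection -/

namespace FlatVB

open Bundle

/-- A smooth real vector bundle over the manifold `M` (modelled on `E`) with model fibre `F`.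
Its rank is the dimension of `F`. -/
structure SmoothBundle (E : Type w) [NormedAddCommGroup E] [NormedSpace ℝ E]
    (F : Type v) [NormedAddCommGroup F] [NormedSpace ℝ F]
    (M : Type u) [TopologicalSpace M] [ChartedSpace E M] : Type (max u (v + 1)) where
  Fiber : M → Type v
  [topTotal : TopologicalSpace (TotalSpace F Fiber)]
  [addCommGroup : ∀ x, AddCommGroup (Fiber x)]
  [module : ∀ x, Module ℝ (Fiber x)]
  [topFiber : ∀ x, TopologicalSpace (Fiber x)]
  [topAddGroup : ∀ x, IsTopologicalAddGroup (Fiber x)]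
  [contSMul : ∀ x, ContinuousSMul ℝ (Fiber x)]
  [fiberBundle : FiberBundle F Fiber]
  [vectorBundle : VectorBundle ℝ F Fiber]
  [smooth : ContMDiffVectorBundle ∞ F Fiber 𝓘(ℝ, E)]

attribute [instance] SmoothBundle.topTotal SmoothBundle.addCommGroup SmoothBundle.module
  SmoothBundle.topFiber SmoothBundle.topAddGroup SmoothBundle.contSMul SmoothBundle.fiberBundle
  SmoothBundle.vectorBundle SmoothBundle.smooth

variable {E : Type w} [NormedAddCommGroup E] [NormedSpace ℝ E]
  {F : Type v} [NormedAddCommGroup F] [NormedSpace ℝ F]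
  {M : Type u} [TopologicalSpace M] [ChartedSpace E M]

/-- Smoothness of a global section. -/
def SmoothBundle.IsSmoothSection (W : SmoothBundle E F M) (s : ∀ x, W.Fiber x) : Prop :=
  ContMDiff 𝓘(ℝ, E) (𝓘(ℝ, E).prod 𝓘(ℝ, F)) ∞ (fun x => TotalSpace.mk' F x (s x))

/-- Smoothness of a global vector field. -/
def IsSmoothVectorField (Y : ∀ x : M, TangentSpace 𝓘(ℝ, E) x) [IsManifold 𝓘(ℝ, E) ∞ M] : Prop :=
  ContMDiff 𝓘(ℝ, E) (𝓘(ℝ, E).prod 𝓘(ℝ, E)) ∞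
    (fun x => (TotalSpace.mk' E x (Y x) : TangentBundle 𝓘(ℝ, E) M))

/-- A flat smooth connection on a smooth vector bundle: a smooth covariant derivative whose
curvature `R(X,Y)s = ∇_X ∇_Y s - ∇_Y ∇_X s - ∇_[X,Y] s` vanishes identically. -/
structure FlatConnection [IsManifold 𝓘(ℝ, E) ∞ M] (W : SmoothBundle E F M) where
  cov : CovariantDerivative 𝓘(ℝ, E) F W.Fiber
  smooth : CovariantDerivative.ContMDiffCovariantDerivative cov ∞
  flat : ∀ (X Y : ∀ x : M, TangentSpace 𝓘(ℝ, E) x) (s : ∀ x, W.Fiber x),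
    IsSmoothVectorField X → IsSmoothVectorField Y → W.IsSmoothSection s →
    ∀ x : M, cov (fun y => cov s y (Y y)) x (X x) - cov (fun y => cov s y (X y)) x (Y x)
      - cov s x (VectorField.mlieBracket 𝓘(ℝ, E) X Y x) = 0

variable (E F M) in
/-- A smooth real vector bundle together with a flat connection. -/
structure FlatBundle [IsManifold 𝓘(ℝ, E) ∞ M] where
  bundle : SmoothBundle E F M
  conn : FlatConnection bundle

/-- Smoothness of a fibrewise map of vector bundles over the identity of `M`. -/
def IsSmoothBundleMap (W W' : SmoothBundle E F M) (φ : ∀ x, W.Fiber x → W'.Fiber x) : Prop :=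
  ContMDiff (𝓘(ℝ, E).prod 𝓘(ℝ, F)) (𝓘(ℝ, E).prod 𝓘(ℝ, F)) ∞
    (fun p : TotalSpace F W.Fiber => TotalSpace.mk' F p.1 (φ p.1 p.2))

lemma IsSmoothBundleMap.comp_section {W W' : SmoothBundle E F M}
    {φ : ∀ x, W.Fiber x → W'.Fiber x} (hφ : IsSmoothBundleMap W W' φ) {s : ∀ x, W.Fiber x}
    (hs : W.IsSmoothSection s) : W'.IsSmoothSection (fun x => φ x (s x)) :=
  ContMDiff.comp hφ hs

/-- An isomorphism of bundles with connection: a smooth vector bundle isomorphism over the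
identity of `M` that carries one connection to the other. -/
structure FlatBundle.Iso [IsManifold 𝓘(ℝ, E) ∞ M] (A B : FlatBundle E F M) where
  toEquiv : ∀ x, A.bundle.Fiber x ≃ₗ[ℝ] B.bundle.Fiber x
  smooth : IsSmoothBundleMap A.bundle B.bundle (fun x => toEquiv x)
  smooth_symm : IsSmoothBundleMap B.bundle A.bundle (fun x => (toEquiv x).symm)
  map_conn : ∀ s : ∀ x, A.bundle.Fiber x, A.bundle.IsSmoothSection s →
    ∀ (x : M) (Y : TangentSpace 𝓘(ℝ, E) x),
      B.conn.cov (fun y => toEquiv y (s y)) x Y = toEquiv x (A.conn.cov s x Y)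

/-- Being isomorphic, as an equivalence relation. -/
instance flatBundleSetoid [IsManifold 𝓘(ℝ, E) ∞ M] : Setoid (FlatBundle E F M) where
  r A B := Nonempty (A.Iso B)
  iseqv :=
    { refl := fun A => ⟨
        { toEquiv := fun x => LinearEquiv.refl ℝ _
          smooth := contMDiff_id
          smooth_symm := contMDiff_id
          map_conn := fun _ _ _ _ => rfl }⟩
      symm := fun {A B} ⟨f⟩ => ⟨
        { toEquiv := fun x => (f.toEquiv x).symm
          smooth := f.smooth_symm
          smooth_symm := by simpa using f.smooth
          map_conn := fun s hs x Y => by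
            have h := f.map_conn _ (f.smooth_symm.comp_section hs) x Y
            simp only [LinearEquiv.apply_symm_apply] at h
            rw [h, LinearEquiv.symm_apply_apply] }⟩
      trans := fun {A B C} ⟨f⟩ ⟨g⟩ => ⟨
        { toEquiv := fun x => (f.toEquiv x).trans (g.toEquiv x)
          smooth := ContMDiff.comp g.smooth f.smooth
          smooth_symm := ContMDiff.comp f.smooth_symm g.smooth_symm
          map_conn := fun s hs x Y => by
            have h := g.map_conn _ (f.smooth.comp_section hs) x Y
            rw [f.map_conn s hs x Y] at h
            exact h }⟩ }

variable (E F M) in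
/-- The set of isomorphism classes of vector bundles over `M` with model fibre `F` and with a
flat connection. -/
abbrev IsoClasses [IsManifold 𝓘(ℝ, E) ∞ M] :=
  Quotient (flatBundleSetoid (E := E) (F := F) (M := M))

/-- The sections `s 1, …, s n` form a smooth frame of parallel sections over the open set `u`.
Only the values of the sections on `u` matter. -/
structure IsParallelFrameOn [IsManifold 𝓘(ℝ, E) ∞ M] {n : ℕ} (A : FlatBundle E F M)
    (s : Fin n → ∀ x, A.bundle.Fiber x) (u : Opens M) : Prop where
  frame : IsLocalFrameOn 𝓘(ℝ, E) F ∞ s (u : Set M)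
  parallel : ∀ i, ∀ x ∈ u, A.conn.cov (s i) x = 0

open Matrix in
/-- The frames `h_α` over the sets `U_α` are related by
`h_αi = ∑ j, (t_αβ)_ij h_βj` on `U_α ∩ U_β`. -/
def IsTransition {n : ℕ} (W : SmoothBundle E F M) (U : Cech.OpenCover M)
    (h : U.Index → Fin n → ∀ x, W.Fiber x) (t : Cech.C1 (GL (Fin n) ℝ) U) : Prop :=
  ∀ (α β : U.Index) (x : M) (hα : x ∈ U.set α) (hβ : x ∈ U.set β) (i : Fin n),
    h α i x = ∑ j, (t α β ⟨x, hα, hβ⟩ : Matrix (Fin n) (Fin n) ℝ) i j • h β j x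

section Gluing

variable [FiniteDimensional ℝ F] {n : ℕ} (b : Module.Basis (Fin n) ℝ F)

open Matrix

/-- The endomorphism `b_i ↦ ∑ j, g_ij b_j` of the model fibre. -/
noncomputable def glAct (g : Matrix (Fin n) (Fin n) ℝ) : F →L[ℝ] F :=
  LinearMap.toContinuousLinearMap (Matrix.toLin b b gᵀ)

lemma glAct_basis (g : Matrix (Fin n) (Fin n) ℝ) (i : Fin n) :
    glAct b g (b i) = ∑ j, g i j • b j := by
  simp [glAct, Matrix.toLin_self]

lemma glAct_one : glAct b 1 = ContinuousLinearMap.id ℝ F := by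
  ext v
  simp [glAct]

lemma glAct_mul (g h : Matrix (Fin n) (Fin n) ℝ) (v : F) :
    glAct b (g * h) v = glAct b h (glAct b g v) := by
  simp [glAct, Matrix.transpose_mul, Matrix.toLin_mul b b b]

variable {U : Cech.OpenCover M} (t : Cech.Z1 (GL (Fin n) ℝ) U)

open Classical in
/-- The transition function from the `α`-coordinates to the `β`-coordinates determined by a
cocycle (and `0` outside of `U_α ∩ U_β`). -/
noncomputable def coordChange (α β : U.Index) (x : M) : F →L[ℝ] F :=
  if h : x ∈ U.set α ⊓ U.set β then glAct b (t.1 α β ⟨x, h⟩ : Matrix (Fin n) (Fin n) ℝ) else 0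

lemma coordChange_of_mem {α β : U.Index} {x : M} (hα : x ∈ U.set α) (hβ : x ∈ U.set β) :
    coordChange b t α β x = glAct b (t.1 α β ⟨x, hα, hβ⟩ : Matrix (Fin n) (Fin n) ℝ) :=
  dif_pos (show x ∈ U.set α ⊓ U.set β from ⟨hα, hβ⟩)

lemma coordChange_eventually {α β : U.Index} {x : M} (hα : x ∈ U.set α) (hβ : x ∈ U.set β) :
    ∀ᶠ y in 𝓝 x, coordChange b t α β y = coordChange b t α β x := by
  have h1 : ∀ᶠ y : ↥(U.set α ⊓ U.set β) in 𝓝 ⟨x, hα, hβ⟩,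
      t.1 α β y = t.1 α β ⟨x, hα, hβ⟩ := (t.1 α β).isLocallyConstant.eventually_eq _
  have h2 := (U.set α ⊓ U.set β).isOpen.isOpenEmbedding_subtypeVal.map_nhds_eq ⟨x, hα, hβ⟩
  have h3 : ∀ᶠ y in 𝓝 x, ∃ h : y ∈ U.set α ⊓ U.set β,
      t.1 α β ⟨y, h⟩ = t.1 α β ⟨x, hα, hβ⟩ := by
    rw [← h2, Filter.eventually_map]
    exact h1.mono fun y hy => ⟨y.2, hy⟩
  filter_upwards [h3] with y ⟨hy, hty⟩
  rw [coordChange_of_mem b t hα hβ, coordChange_of_mem b t hy.1 hy.2, hty]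

/-- The gluing data of the vector bundle with the transition functions `t`. -/
noncomputable def gluedCore : VectorBundleCore ℝ M F U.Index where
  baseSet α := U.set α
  isOpen_baseSet α := (U.set α).isOpen
  indexAt x := (U.covers x).choose
  mem_baseSet_at x := (U.covers x).choose_spec
  coordChange := coordChange b t
  coordChange_self α x hx v := by
    have h := (Cech.d1_eq_one_iff t.1).1 t.2 α α α x hx hx hx
    rw [coordChange_of_mem b t hx hx, mul_eq_left.mp h]
    simp [glAct_one]
  continuousOn_coordChange α β x hx :=
    (continuousAt_const.congr (Filter.EventuallyEq.symm
      (coordChange_eventually b t hx.1 hx.2))).continuousWithinAt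
  coordChange_comp α β γ x hx v := by
    obtain ⟨⟨hα, hβ⟩, hγ⟩ := hx
    rw [coordChange_of_mem b t hα hβ, coordChange_of_mem b t hβ hγ, coordChange_of_mem b t hα hγ,
      ← (Cech.d1_eq_one_iff t.1).1 t.2 α β γ x hα hβ hγ, ← glAct_mul]
    rfl

instance gluedCore_isContMDiff : (gluedCore b t).IsContMDiff 𝓘(ℝ, E) ∞ where
  contMDiffOn_coordChange _ _ _ hx :=
    (contMDiffAt_const.congr_of_eventuallyEq
      (coordChange_eventually b t hx.1 hx.2)).contMDiffWithinAt

/-- The smooth vector bundle glued from the products `U_α × F` by means of the locally constant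
transition functions `t_αβ`. -/
noncomputable def gluedBundle : SmoothBundle E F M where
  Fiber := (gluedCore b t).Fiber
  topAddGroup _ := inferInstanceAs (IsTopologicalAddGroup F)
  contSMul _ := inferInstanceAs (ContinuousSMul ℝ F)

/-- The canonical basis `e_αi` of sections over `U_α` of the glued bundle: the constant sections
in the local trivialization over `U_α`. -/
noncomputable def canonicalFrame (α : U.Index) (i : Fin n) (x : M) :
    (gluedBundle (E := E) b t).Fiber x :=
  ((gluedCore b t).localTriv α).symm x (b i)

end Gluing

end FlatVB

set_option maxSynthPendingDepth 3
set_option linter.unusedSectionVars false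

/-! ### Parallel sections of a flat connection form on a normed space -/

namespace FlatForm

open Metric Set Filter

variable {E : Type w} [NormedAddCommGroup E] [NormedSpace ℝ E]
  {F : Type v} [NormedAddCommGroup F] [NormedSpace ℝ F]

/-- The curvature `dA + A ∧ A` of the connection form `A` vanishes at `z`. -/
def IsFlatAt (A : E → E →L[ℝ] F →L[ℝ] F) (z : E) : Prop :=
  ∀ (v w : E) (f : F), fderiv ℝ A z v w f - fderiv ℝ A z w v f
    + A z v (A z w f) - A z w (A z v f) = 0

/-- Quantitative smoothness of the connection form `A` on a ball. -/
structure IsBoundedOn (A : E → E →L[ℝ] F →L[ℝ] F) (C : ℝ) (s : Set E) : Prop where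
  contDiffAt : ∀ z ∈ s, ContDiffAt ℝ ∞ A z
  flat : ∀ z ∈ s, IsFlatAt A z
  norm_le : ∀ z ∈ s, ‖A z‖ ≤ C
  norm_fderiv_le : ∀ z ∈ s, ‖fderiv ℝ A z‖ ≤ C
  lipschitz : ∀ z ∈ s, ∀ z' ∈ s, ‖fderiv ℝ A z - fderiv ℝ A z'‖ ≤ C * ‖z - z'‖

lemma exists_isBoundedOn {A : E → E →L[ℝ] F →L[ℝ] F} {z₀ : E} (hA : ∀ᶠ z in 𝓝 z₀, ContDiffAt ℝ ∞ A z)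
    (hflat : ∀ᶠ z in 𝓝 z₀, IsFlatAt A z) :
    ∃ C > 0, ∃ r > 0, C * r ≤ 1 / 2 ∧ IsBoundedOn A C (ball z₀ r) := by
  have h1 : ContDiffAt ℝ 1 (fderiv ℝ A) z₀ := hA.self_of_nhds.fderiv_right (m := 1) (by norm_cast)
  obtain ⟨K, t, ht, hK⟩ := h1.exists_lipschitzOnWith
  set C : ℝ := max (max (‖A z₀‖ + 1) (‖fderiv ℝ A z₀‖ + 1)) K with hC
  have hC1 : ‖A z₀‖ < C := lt_of_lt_of_le (lt_add_one _) ((le_max_left _ _).trans (le_max_left _ _))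
  have hC2 : ‖fderiv ℝ A z₀‖ < C :=
    lt_of_lt_of_le (lt_add_one _) ((le_max_right _ _).trans (le_max_left _ _))
  have hC0 : 0 < C := (norm_nonneg _).trans_lt hC1
  have e1 : ∀ᶠ z in 𝓝 z₀, ‖A z‖ < C := hA.self_of_nhds.continuousAt.norm.eventually_lt continuousAt_const hC1
  have e2 : ∀ᶠ z in 𝓝 z₀, ‖fderiv ℝ A z‖ < C :=
    h1.continuousAt.norm.eventually_lt continuousAt_const hC2
  obtain ⟨r, hr, hball⟩ := Metric.eventually_nhds_iff_ball.1 (e1.and (e2.and (hA.and (hflat.and ht))))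
  refine ⟨C, hC0, min r (1 / (2 * C)), by positivity, ?_, ?_⟩
  · calc C * min r (1 / (2 * C)) ≤ C * (1 / (2 * C)) := by gcongr; exact min_le_right _ _
      _ = 1 / 2 := by field_simp
  · have hb : ∀ z ∈ ball z₀ (min r (1 / (2 * C))), z ∈ ball z₀ r :=
      fun z hz => ball_subset_ball (min_le_left _ _) hz
    exact
    { contDiffAt := fun z hz => (hball z (hb z hz)).2.2.1
      flat := fun z hz => (hball z (hb z hz)).2.2.2.1
      norm_le := fun z hz => (hball z (hb z hz)).1.le
      norm_fderiv_le := fun z hz => (hball z (hb z hz)).2.1.le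
      lipschitz := fun z hz z' hz' => by
        have := hK.norm_sub_le (hball z (hb z hz)).2.2.2.2 (hball z' (hb z' hz')).2.2.2.2
        exact this.trans (by gcongr; exact le_max_right _ _) }

/-- The radial vector field `y ↦ -A(z₀ + t x)(x) y` whose integral curves are the parallel
sections along the ray from `z₀` in the direction `x`. -/
noncomputable def radial (A : E → E →L[ℝ] F →L[ℝ] F) (z₀ x : E) (t : ℝ) (y : F) : F := -(A (z₀ + t • x) x y)

section

variable {A : E → E →L[ℝ] F →L[ℝ] F} {C r : ℝ} {z₀ : E}

lemma add_smul_mem_ball {x : E} (hx : ‖x‖ < r) {t : ℝ} (ht : t ∈ Icc (0 : ℝ) 1) :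
    z₀ + t • x ∈ ball z₀ r := by
  rw [mem_ball, dist_self_add_left, norm_smul, Real.norm_of_nonneg ht.1]
  exact (mul_le_of_le_one_left (norm_nonneg _) ht.2).trans_lt hx

namespace IsBoundedOn

variable (hA : IsBoundedOn A C (ball z₀ r))
include hA

lemma norm_radial_le {x : E} (hx : ‖x‖ < r) {t : ℝ} (ht : t ∈ Icc (0 : ℝ) 1) :
    ‖A (z₀ + t • x) x‖ ≤ C * r := by
  have h := hA.norm_le _ (add_smul_mem_ball hx ht)
  calc ‖A (z₀ + t • x) x‖ ≤ ‖A (z₀ + t • x)‖ * ‖x‖ := ContinuousLinearMap.le_opNorm _ _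
    _ ≤ C * r := mul_le_mul h hx.le (norm_nonneg _) ((norm_nonneg _).trans h)

lemma continuousOn_radial {x : E} (hx : ‖x‖ < r) (y : F) :
    ContinuousOn (fun t => radial A z₀ x t y) (Icc 0 1) := by
  have h1 : ContinuousOn (fun t : ℝ => A (z₀ + t • x)) (Icc 0 1) := fun t ht =>
    ContinuousAt.continuousWithinAt <| ContinuousAt.comp (g := A) (f := fun t : ℝ => z₀ + t • x)
      (hA.contDiffAt _ (add_smul_mem_ball hx ht)).continuousAt (by fun_prop)
  exact ((h1.clm_apply continuousOn_const).clm_apply continuousOn_const).neg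

lemma exists_radial_solution [CompleteSpace F] (hCr : C * r ≤ 1 / 2) {x : E} (hx : ‖x‖ < r)
    (f : F) : ∃ G : ℝ → F, G 0 = f ∧
      ∀ t ∈ Icc (0 : ℝ) 1, HasDerivWithinAt G (radial A z₀ x t (G t)) (Icc 0 1) t := by
  let a : NNReal := ⟨‖f‖ + 1, by positivity⟩
  have key : IsPicardLindelof (radial A z₀ x) (⟨0, by simp⟩ : Icc (0 : ℝ) 1) f a 0 a 1 :=
  { lipschitzOnWith := fun t ht => by
      refine LipschitzOnWith.of_dist_le_mul fun y _ y' _ => ?_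
      have h : radial A z₀ x t y - radial A z₀ x t y' = -(A (z₀ + t • x) x (y - y')) := by
        simp [radial]; abel
      rw [dist_eq_norm, dist_eq_norm, h, norm_neg]
      refine (ContinuousLinearMap.le_opNorm _ _).trans ?_
      gcongr
      exact (hA.norm_radial_le hx ht).trans (hCr.trans (by norm_num))
    continuousOn := fun y _ => hA.continuousOn_radial hx y
    norm_le := fun t ht y hy => by
      have h1 : ‖y‖ ≤ ‖f‖ + (‖f‖ + 1) := by
        have h2 : ‖y - f‖ ≤ ‖f‖ + 1 := by rwa [mem_closedBall, dist_eq_norm] at hy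
        calc ‖y‖ = ‖f + (y - f)‖ := by rw [add_sub_cancel]
          _ ≤ ‖f‖ + ‖y - f‖ := norm_add_le _ _
          _ ≤ _ := by gcongr
      rw [radial, norm_neg]
      calc ‖A (z₀ + t • x) x y‖ ≤ ‖A (z₀ + t • x) x‖ * ‖y‖ := ContinuousLinearMap.le_opNorm _ _
        _ ≤ (1 / 2) * (‖f‖ + (‖f‖ + 1)) := by
          gcongr
          exact (hA.norm_radial_le hx ht).trans hCr
        _ ≤ ‖f‖ + 1 := by linarith
    mul_max_le := by simp }
  exact key.exists_eq_forall_mem_Icc_hasDerivWithinAt₀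

lemma norm_map_sub_le {p p' : E} (hp : p ∈ ball z₀ r) (hp' : p' ∈ ball z₀ r) :
    ‖A p' - A p‖ ≤ C * ‖p' - p‖ :=
  (convex_ball z₀ r).norm_image_sub_le_of_norm_fderiv_le
    (fun z hz => (hA.contDiffAt z hz).differentiableAt (by simp)) hA.norm_fderiv_le hp hp'

lemma norm_map_sub_sub_le (hC : 0 < C) {p p' : E} (hp : p ∈ ball z₀ r) (hp' : p' ∈ ball z₀ r) :
    ‖A p' - A p - fderiv ℝ A p (p' - p)‖ ≤ C * ‖p' - p‖ * ‖p' - p‖ := by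
  have hconv : Convex ℝ (ball z₀ r ∩ closedBall p ‖p' - p‖) :=
    (convex_ball _ _).inter (convex_closedBall _ _)
  refine hconv.norm_image_sub_le_of_norm_fderiv_le'
    (fun z hz => (hA.contDiffAt z hz.1).differentiableAt (by simp)) (fun z hz => ?_)
    ⟨hp, by simp⟩ ⟨hp', by simp [dist_eq_norm]⟩
  refine (hA.lipschitz z hz.1 p hp).trans ?_
  gcongr
  simpa [dist_eq_norm] using hz.2

/-- Along the ray in the direction `x + h`, the curve `G - t A(h) G` built from a solution `G` along
the ray in the direction `x` solves the radial equation up to an error of order `‖h‖²`. -/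
lemma approx (hC : 0 < C) {x h : E} (hx : ‖x‖ < r) (hxh : ‖x + h‖ < r) {G : ℝ → F} {K : ℝ}
    (hK : ∀ t ∈ Icc (0 : ℝ) 1, ‖G t‖ ≤ K)
    (hG : ∀ t ∈ Icc (0 : ℝ) 1, HasDerivWithinAt G (radial A z₀ x t (G t)) (Icc 0 1) t)
    {t : ℝ} (ht : t ∈ Icc (0 : ℝ) 1) :
    ∃ q', HasDerivWithinAt (fun t => G t - t • A (z₀ + t • x) h (G t)) q' (Icc 0 1) t ∧
      ‖q' - radial A z₀ (x + h) t (G t - t • A (z₀ + t • x) h (G t))‖ ≤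
        (C * r + C + (C * r + C) * C) * K * ‖h‖ ^ 2 := by
  have hmem := add_smul_mem_ball (z₀ := z₀) hx ht
  have hmem' := add_smul_mem_ball (z₀ := z₀) hxh ht
  set p := z₀ + t • x with hp
  set p' := z₀ + t • (x + h) with hp'
  set D := fderiv ℝ A p with hD
  have hAd : HasFDerivAt A D p :=
    ((hA.contDiffAt _ hmem).differentiableAt (by simp)).hasFDerivAt
  have hline : HasDerivWithinAt (fun t : ℝ => z₀ + t • x) x (Icc 0 1) t := by
    simpa using (((hasDerivAt_id t).smul_const x).const_add z₀).hasDerivWithinAt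
  have h1 : HasDerivWithinAt (fun t : ℝ => A (z₀ + t • x)) (D x) (Icc 0 1) t :=
    hAd.comp_hasDerivWithinAt_of_eq t hline rfl
  have h2 : HasDerivWithinAt (fun t : ℝ => A (z₀ + t • x) h) (D x h) (Icc 0 1) t := by
    simpa using h1.clm_apply (hasDerivWithinAt_const t _ h)
  have h3 := h2.clm_apply (hG t ht)
  have h4 := (hG t ht).sub ((hasDerivWithinAt_id t _).smul h3)
  refine ⟨_, h4, ?_⟩
  have hflat := hA.flat p hmem x h (G t)
  have hpp : p' - p = t • h := by simp [hp, hp']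
  have hth : ‖t • h‖ ≤ ‖h‖ := by
    rw [norm_smul, Real.norm_of_nonneg ht.1]
    exact mul_le_of_le_one_left (norm_nonneg _) ht.2
  have b1 : ‖A p' - A p‖ ≤ C * ‖h‖ := by
    refine (hA.norm_map_sub_le hmem hmem').trans ?_
    rw [hpp]; gcongr
  have b2 : ‖A p' - A p - D (t • h)‖ ≤ C * ‖h‖ * ‖h‖ := by
    have h := hA.norm_map_sub_sub_le hC hmem hmem'
    rw [hpp] at h
    refine h.trans ?_
    gcongr
  have b3 : ‖A p'‖ ≤ C := hA.norm_le _ hmem'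
  have b4 : ‖A p‖ ≤ C := hA.norm_le _ hmem
  have hKt := hK t ht
  have hK0 : 0 ≤ K := (norm_nonneg _).trans hKt
  have hr0 : 0 ≤ r := (norm_nonneg _).trans hx.le
  have key : radial A z₀ x t (G t) - (id t • (D x h (G t) + A p h (radial A z₀ x t (G t)))
      + (1 : ℝ) • A p h (G t)) - radial A z₀ (x + h) t (G t - t • A p h (G t)) =
      (A p' - A p - D (t • h)) x (G t) + (A p' - A p) h (G t)
        - t • ((A p' - A p) x + A p' h) (A p h (G t)) := by
    have hflat' : D x h (G t) =
        D h x (G t) - A p x (A p h (G t)) + A p h (A p x (G t)) := by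
      rw [← sub_eq_zero, ← hflat]; abel
    have e1 : radial A z₀ x t (G t) = -(A p x (G t)) := rfl
    have e2 (y : F) : radial A z₀ (x + h) t y = -(A p' (x + h) y) := rfl
    simp only [e1, e2, hflat', map_sub, map_add, map_neg, map_smul, id,
      _root_.sub_apply, _root_.add_apply, _root_.smul_apply,
      one_smul, smul_add, smul_sub, smul_neg]
    abel
  have n1 : ‖(A p' - A p - D (t • h)) x (G t)‖ ≤ C * ‖h‖ * ‖h‖ * r * K :=
    (ContinuousLinearMap.le_opNorm₂ _ _ _).trans (by gcongr)
  have n2 : ‖(A p' - A p) h (G t)‖ ≤ C * ‖h‖ * ‖h‖ * K :=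
    (ContinuousLinearMap.le_opNorm₂ _ _ _).trans (by gcongr)
  have n3 : ‖A p h (G t)‖ ≤ C * ‖h‖ * K :=
    (ContinuousLinearMap.le_opNorm₂ _ _ _).trans (by gcongr)
  have n4 : ‖(A p' - A p) x + A p' h‖ ≤ C * ‖h‖ * r + C * ‖h‖ :=
    (norm_add_le _ _).trans (add_le_add
      ((ContinuousLinearMap.le_opNorm _ _).trans (by gcongr))
      ((ContinuousLinearMap.le_opNorm _ _).trans (by gcongr)))
  have n5 : ‖t • ((A p' - A p) x + A p' h) (A p h (G t))‖ ≤
      (C * ‖h‖ * r + C * ‖h‖) * (C * ‖h‖ * K) := by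
    rw [norm_smul, Real.norm_of_nonneg ht.1]
    refine (mul_le_of_le_one_left (norm_nonneg _) ht.2).trans
      ((ContinuousLinearMap.le_opNorm _ _).trans ?_)
    gcongr
  rw [key]
  refine (_root_.norm_sub_le _ _).trans ((add_le_add (norm_add_le _ _) n5).trans
    ((add_le_add (add_le_add n1 n2) le_rfl).trans (le_of_eq ?_)))
  ring

lemma hasFDerivAt_of_radial (hC : 0 < C) {σ : E → ℝ → F}
    (h0 : ∀ x, ‖x‖ < r → ∀ x', ‖x'‖ < r → σ x 0 = σ x' 0)
    (hσ : ∀ x, ‖x‖ < r → ∀ t ∈ Icc (0 : ℝ) 1,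
      HasDerivWithinAt (σ x) (radial A z₀ x t (σ x t)) (Icc 0 1) t) {x : E} (hx : ‖x‖ < r) :
    HasFDerivAt (fun x => σ x 1) (-(A (z₀ + x)).flip (σ x 1)) x := by
  have hcont : ∀ x, ‖x‖ < r → ContinuousOn (σ x) (Icc 0 1) := fun x hx t ht =>
    (hσ x hx t ht).continuousWithinAt
  obtain ⟨K, hK⟩ := isCompact_Icc.exists_bound_of_continuousOn (hcont x hx)
  have hr0 : 0 < r := (norm_nonneg _).trans_lt hx
  set B := (C * r + C + (C * r + C) * C) * K with hB
  let k : NNReal := ⟨C * r, by positivity⟩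
  have hk : (k : ℝ) ≠ 0 := (mul_pos hC hr0).ne'
  have est : ∀ h, ‖x + h‖ < r → ‖σ (x + h) 1 - σ x 1 - (-(A (z₀ + x)).flip (σ x 1)) h‖ ≤
      B / k * (Real.exp k - 1) * ‖h‖ ^ 2 := by
    intro h hxh
    choose! q' hq' hq using fun t ht => hA.approx hC hx hxh hK (hσ x hx) (t := t) ht
    have hIci : ∀ t ∈ Ico (0 : ℝ) 1, Icc (0 : ℝ) 1 ∈ 𝓝[Ici t] t := fun t ht =>
      mem_of_superset (Icc_mem_nhdsGE ht.2) (Icc_subset_Icc_left ht.1)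
    have hIcc : ∀ t ∈ Ico (0 : ℝ) 1, t ∈ Icc (0 : ℝ) 1 := fun t ht => Ico_subset_Icc_self ht
    have gr := dist_le_of_approx_trajectories_ODE_of_mem (v := radial A z₀ (x + h)) (K := k)
      (s := fun _ => univ) (a := 0) (b := 1) (δ := 0) (εf := 0) (εg := B * ‖h‖ ^ 2)
      (f := σ (x + h)) (g := fun t => σ x t - t • A (z₀ + t • x) h (σ x t))
      (f' := fun t => radial A z₀ (x + h) t (σ (x + h) t)) (g' := q')
      (fun t ht => LipschitzOnWith.of_dist_le_mul fun y _ y' _ => by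
        have h : radial A z₀ (x + h) t y - radial A z₀ (x + h) t y' =
            -(A (z₀ + t • (x + h)) (x + h) (y - y')) := by
          simp only [radial, map_sub]; abel
        rw [dist_eq_norm, dist_eq_norm, h, norm_neg]
        exact (ContinuousLinearMap.le_opNorm _ _).trans
          (mul_le_mul_of_nonneg_right (hA.norm_radial_le hxh (hIcc t ht)) (norm_nonneg _)))
      (hcont _ hxh)
      (fun t ht => (hσ _ hxh t (hIcc t ht)).mono_of_mem_nhdsWithin (hIci t ht))
      (fun t _ => by simp) (fun _ _ => mem_univ _)
      (fun t ht => (hq' t ht).continuousWithinAt)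
      (fun t ht => (hq' t (hIcc t ht)).mono_of_mem_nhdsWithin (hIci t ht))
      (fun t ht => by rw [dist_eq_norm]; exact hq t (hIcc t ht)) (fun _ _ => mem_univ _)
      (by simp [h0 _ hxh _ hx]) 1 (by simp)
    rw [gronwallBound_of_K_ne_0 hk, dist_eq_norm] at gr
    simp only [one_smul, sub_zero, mul_one, zero_mul, zero_add] at gr
    have e : σ (x + h) 1 - σ x 1 - (-(A (z₀ + x)).flip (σ x 1)) h =
        σ (x + h) 1 - (σ x 1 - A (z₀ + x) h (σ x 1)) := by
      simp only [_root_.neg_apply, ContinuousLinearMap.flip_apply]; abel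
    rw [e]
    refine gr.trans (le_of_eq ?_)
    ring
  rw [hasFDerivAt_iff_isLittleO_nhds_zero]
  have hev : ∀ᶠ h in 𝓝 (0 : E), ‖x + h‖ < r := by
    have : ContinuousAt (fun h : E => ‖x + h‖) 0 := by fun_prop
    exact this.eventually_lt continuousAt_const (by simpa using hx)
  refine Asymptotics.IsBigO.trans_isLittleO (g := fun h : E => ‖h‖ ^ 2)
    (Asymptotics.IsBigO.of_bound (B / k * (Real.exp k - 1)) ?_) ?_
  · filter_upwards [hev] with h hh
    rw [norm_pow, norm_norm]
    exact est h hh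
  · exact Asymptotics.isLittleO_norm_pow_id one_lt_two

end IsBoundedOn

end

/-- A solution of `dσ = -A σ` is as smooth as `A`. -/
lemma contDiffOn_of_hasFDerivAt {A : E → E →L[ℝ] F →L[ℝ] F} {s : Set E} (hs : IsOpen s)
    (hA : ContDiffOn ℝ ∞ A s) {σ : E → F}
    (hσ : ∀ z ∈ s, HasFDerivAt σ (-(A z).flip (σ z)) z) : ContDiffOn ℝ ∞ σ s := by
  rw [contDiffOn_infty]
  intro n
  induction n with
  | zero => exact contDiffOn_zero.2 fun z hz => (hσ z hz).continuousAt.continuousWithinAt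
  | succ n ih =>
    have e : ((n + 1 : ℕ) : ℕ∞ω) = (n : ℕ∞ω) + 1 := by push_cast; rfl
    rw [e, contDiffOn_succ_iff_fderiv_of_isOpen hs]
    refine ⟨fun z hz => (hσ z hz).differentiableAt.differentiableWithinAt, by simp, ?_⟩
    refine ContDiffOn.congr (f := fun z => -(A z).flip (σ z)) ?_ fun z hz => (hσ z hz).fderiv
    have h1 : ContDiffOn ℝ n (fun z => (A z).flip) s :=
      (ContinuousLinearMap.flipₗᵢ ℝ E F F).toContinuousLinearEquiv.contDiff.comp_contDiffOn
        (hA.of_le (by exact_mod_cast le_top))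
    exact (h1.clm_apply ih).neg

/-- **Frobenius theorem** for flat connection forms: near `z₀` there are smooth parallel sections
with arbitrary value at `z₀`. -/
theorem exists_parallel [CompleteSpace F] {A : E → E →L[ℝ] F →L[ℝ] F} {z₀ : E}
    (hA : ∀ᶠ z in 𝓝 z₀, ContDiffAt ℝ ∞ A z) (hflat : ∀ᶠ z in 𝓝 z₀, IsFlatAt A z) :
    ∃ r > 0, ∀ f : F, ∃ σ : E → F, σ z₀ = f ∧ ContDiffOn ℝ ∞ σ (ball z₀ r) ∧
      ∀ z ∈ ball z₀ r, HasFDerivAt σ (-(A z).flip (σ z)) z := by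
  obtain ⟨C, hC, r, hr, hCr, hb⟩ := exists_isBoundedOn hA hflat
  refine ⟨r, hr, fun f => ?_⟩
  choose! G hG0 hG using fun x (hx : ‖x‖ < r) => hb.exists_radial_solution hCr hx f
  have hd : ∀ z ∈ ball z₀ r, HasFDerivAt (fun z => G (z - z₀) 1)
      (-(A z).flip (G (z - z₀) 1)) z := by
    intro z hz
    have hz' : ‖z - z₀‖ < r := by rwa [mem_ball, dist_eq_norm] at hz
    have h1 := hb.hasFDerivAt_of_radial hC
      (fun x hx x' hx' => (hG0 x hx).trans (hG0 x' hx').symm) hG hz'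
    rw [add_sub_cancel] at h1
    exact h1.comp z ((hasFDerivAt_id z).sub_const z₀)
  refine ⟨fun z => G (z - z₀) 1, ?_, contDiffOn_of_hasFDerivAt isOpen_ball
    (fun z hz => (hb.contDiffAt z hz).contDiffWithinAt) hd, hd⟩
  have h0 : ‖(0 : E)‖ < r := by simpa using hr
  have hconst : ∀ t ∈ Icc (0 : ℝ) 1, HasDerivWithinAt (G 0) 0 (Icc 0 1) t := fun t ht => by
    simpa [radial] using hG 0 h0 t ht
  have h1 := (convex_Icc (0 : ℝ) 1).norm_image_sub_le_of_norm_hasDerivWithin_le (C := 0)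
    hconst (by simp) (left_mem_Icc.2 zero_le_one) (right_mem_Icc.2 zero_le_one)
  simp only [zero_mul, norm_le_zero_iff, sub_eq_zero] at h1
  simpa [h1] using hG0 0 h0

end FlatForm

/-! ### Local frames and extension of sections -/

section Sections

open Bundle Set Filter

variable {E : Type*} [NormedAddCommGroup E] [NormedSpace ℝ E]
  {M : Type*} [TopologicalSpace M] [ChartedSpace E M]
  {F : Type*} [NormedAddCommGroup F] [NormedSpace ℝ F]
  {V : M → Type*} [TopologicalSpace (TotalSpace F V)]
  [∀ x, AddCommGroup (V x)] [∀ x, Module ℝ (V x)] [∀ x : M, TopologicalSpace (V x)]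
  [FiberBundle F V] [VectorBundle ℝ F V]

/-- A smooth section over an open set agrees near each point of this set with a global one. -/
lemma exists_contMDiff_section_eventuallyEq [FiniteDimensional ℝ E] [T2Space M]
    [IsManifold 𝓘(ℝ, E) ∞ M] {u : Set M} (hu : IsOpen u) {σ : Π x, V x}
    (hσ : CMDiff[u] ∞ (T% σ)) {x : M} (hx : x ∈ u) :
    ∃ σ' : Π x, V x, CMDiff ∞ (T% σ') ∧ ∀ᶠ y in 𝓝 x, σ' y = σ y := by
  obtain ⟨f, -, hf⟩ := (SmoothBumpFunction.nhds_basis_tsupport (I := 𝓘(ℝ, E)) x).mem_iff.1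
    (hu.mem_nhds hx)
  refine ⟨(f : M → ℝ) • σ, f.contMDiff.contMDiffOn.smul_section_of_tsupport hu hf hσ, ?_⟩
  filter_upwards [f.eventuallyEq_one] with y hy
  simp [hy]

namespace IsLocalFrameOn

variable {ι : Type*} [Finite ι] {s : ι → Π x, V x} {u : Set M}

/-- The coefficients with respect to a smooth local frame are smooth functions on the total
space. -/
lemma contMDiffAt_coeff_totalSpace [ContMDiffVectorBundle ∞ F V 𝓘(ℝ, E)]
    (hs : IsLocalFrameOn 𝓘(ℝ, E) F ∞ s u) (hu : IsOpen u) {p : TotalSpace F V} (hp : p.1 ∈ u)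
    (i : ι) : CMDiffAt ∞ (fun q : TotalSpace F V => hs.coeff i q.1 q.2) p := by
  have := Fintype.ofFinite ι
  let e := trivializationAt F V p.1
  have hpe : p.1 ∈ e.baseSet := mem_baseSet_trivializationAt F V p.1
  let H : M → (ι → ℝ) →L[ℝ] F := fun y =>
    ∑ i, (ContinuousLinearMap.proj (R := ℝ) (φ := fun _ : ι => ℝ) i).smulRight
      (e (T% (s i) y)).2
  have hH : CMDiffAt ∞ H p.1 := by
    refine ContMDiffAt.sum fun i _ => ?_
    have h1 : CMDiffAt ∞ (fun y => (e (T% (s i) y)).2) p.1 :=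
      (e.contMDiffAt_section_iff hpe).1 (hs.contMDiffAt hu hp i)
    exact (ContinuousLinearMap.smulRightL ℝ (ι → ℝ) F
      (ContinuousLinearMap.proj i)).contMDiff.contMDiffAt.comp p.1 h1
  have key : ∀ y (hy : y ∈ u) (hye : y ∈ e.baseSet), H y =
      (((hs.toBasisAt hy).equivFun.symm.trans
        (e.linearEquivAt ℝ y hye)).toContinuousLinearEquiv : (ι → ℝ) ≃L[ℝ] F) := by
    intro y hy hye
    ext c
    simp [H, Module.Basis.equivFun_symm_apply, map_sum]
  have hinv : CMDiffAt ∞ (fun y => (H y).inverse) p.1 := by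
    have h1 : ContDiffAt ℝ ∞ ContinuousLinearMap.inverse (H p.1) := by
      rw [key _ hp hpe]
      exact contDiffAt_map_inverse _
    exact h1.contMDiffAt.comp p.1 hH
  have hproj : CMDiffAt ∞ (fun q : TotalSpace F V => q.1) p := contMDiffAt_proj V
  have hsnd : CMDiffAt ∞ (fun q : TotalSpace F V => (e q).2) p :=
    (contMDiffAt_totalSpace.1 (contMDiffAt_id (x := p))).2
  have hcomp : ContMDiffAt (𝓘(ℝ, E).prod 𝓘(ℝ, F)) 𝓘(ℝ, ι → ℝ) ∞
      (fun q : TotalSpace F V => (H q.1).inverse (e q).2) p :=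
    (hinv.comp p hproj).clm_apply hsnd
  have hcomp' : CMDiffAt ∞ (fun q : TotalSpace F V => (H q.1).inverse (e q).2 i) p :=
    (ContinuousLinearMap.proj (R := ℝ) (φ := fun _ : ι => ℝ) i).contMDiff.contMDiffAt.comp p hcomp
  refine hcomp'.congr_of_eventuallyEq ?_
  have hmem : ∀ᶠ q : TotalSpace F V in 𝓝 p, q.1 ∈ u ∩ e.baseSet :=
    (FiberBundle.continuous_proj F V).continuousAt.eventually_mem
      ((hu.inter e.open_baseSet).mem_nhds ⟨hp, hpe⟩)
  filter_upwards [hmem] with q hq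
  rw [key _ hq.1 hq.2, ContinuousLinearMap.inverse_equiv]
  rw [coeff, dif_pos hq.1]
  change _ = (hs.toBasisAt hq.1).equivFun ((e.linearEquivAt ℝ q.1 hq.2).symm
    (e.linearEquivAt ℝ q.1 hq.2 q.2)) i
  rw [LinearEquiv.symm_apply_apply]
  rfl

variable [ContMDiffVectorBundle ∞ F V 𝓘(ℝ, E)] (hs : IsLocalFrameOn 𝓘(ℝ, E) F ∞ s u)
  (hu : IsOpen u)
include hu

lemma contMDiffAt_coeff {σ : Π x, V x} {x : M} (hx : x ∈ u) (hσ : CMDiffAt ∞ (T% σ) x) (i : ι) :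
    CMDiffAt ∞ (fun y => hs.coeff i y (σ y)) x :=
  (hs.contMDiffAt_coeff_totalSpace hu (p := ⟨x, σ x⟩) hx i).comp x hσ

lemma mdifferentiableAt_coeff {σ : Π x, V x} {x : M} (hx : x ∈ u) (hσ : MDiffAt (T% σ) x)
    (i : ι) : MDiffAt (fun y => hs.coeff i y (σ y)) x :=
  ((hs.contMDiffAt_coeff_totalSpace hu (p := ⟨x, σ x⟩) hx i).mdifferentiableAt (by simp)).comp x hσ

end IsLocalFrameOn

namespace CovariantDerivative

variable [∀ x, IsTopologicalAddGroup (V x)] [∀ x, ContinuousSMul ℝ (V x)]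
  (D : CovariantDerivative 𝓘(ℝ, E) F V)

omit [VectorBundle ℝ F V] in
lemma congr_of_eventuallyEq {σ σ' : Π x, V x} {x : M} (hσ : MDiffAt (T% σ) x)
    (h : ∀ᶠ y in 𝓝 x, σ' y = σ y) : D σ' x = D σ x := by
  have hσ' : MDiffAt (T% σ') x :=
    hσ.congr_of_eventuallyEq (h.mono fun y hy => by simp [hy])
  exact D.isCovariantDerivativeOnUniv.congr_of_eventuallyEq hσ' hσ univ_mem h

lemma sum_smul {ι : Type*} (t : Finset ι) {c : ι → M → ℝ} {s : ι → Π x, V x} {x : M}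
    (hc : ∀ i ∈ t, MDiffAt (c i) x) (hs : ∀ i ∈ t, MDiffAt (T% (s i)) x) :
    D (fun y => ∑ i ∈ t, c i y • s i y) x =
      ∑ i ∈ t, (c i x • D (s i) x + (d% (c i) x).smulRight (s i x)) := by
  classical
  induction t using Finset.induction_on with
  | empty =>
    simp only [Finset.sum_empty]
    exact D.isCovariantDerivativeOnUniv.zero (x := x) trivial
  | insert a t ha ih =>
    have hc' := fun i hi => hc i (Finset.mem_insert_of_mem hi)
    have hs' := fun i hi => hs i (Finset.mem_insert_of_mem hi)
    have h1 := hc a (Finset.mem_insert_self _ _)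
    have h2 := hs a (Finset.mem_insert_self _ _)
    simp only [Finset.sum_insert ha]
    rw [← ih hc' hs', ← D.isCovariantDerivativeOnUniv.leibniz h2 h1]
    exact D.isCovariantDerivativeOnUniv.add (h1.smul_section h2)
      (.sum_section fun i hi => (hc' i hi).smul_section (hs' i hi))

/-- The derivative of a section is computed from its coefficients in a local frame. -/
lemma eq_sum_coeff [ContMDiffVectorBundle ∞ F V 𝓘(ℝ, E)] {ι : Type*} [Fintype ι]
    {s : ι → Π x, V x} {u : Set M}
    (hs : IsLocalFrameOn 𝓘(ℝ, E) F ∞ s u) (hu : IsOpen u) {σ : Π x, V x} {x : M} (hx : x ∈ u)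
    (hσ : MDiffAt (T% σ) x) :
    D σ x = ∑ i, (hs.coeff i x (σ x) • D (s i) x +
      (d% (fun y => hs.coeff i y (σ y)) x).smulRight (s i x)) := by
  have h1 := fun i => hs.mdifferentiableAt_coeff hu hx hσ i
  have h2 := fun i => (hs.contMDiffAt hu hx i).mdifferentiableAt (by simp)
  rw [← D.sum_smul Finset.univ (fun i _ => h1 i) (fun i _ => h2 i)]
  exact D.congr_of_eventuallyEq (.sum_section fun i _ => (h1 i).smul_section (h2 i))
    (hs.eventually_eq_sum_coeff_smul σ (hu.mem_nhds hx))

end CovariantDerivative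

end Sections

/-! ### Coordinate vector fields -/

section CoordField

open Bundle Set Filter

variable {E : Type*} [NormedAddCommGroup E] [NormedSpace ℝ E]
  {M : Type*} [TopologicalSpace M] [ChartedSpace E M] [IsManifold 𝓘(ℝ, E) ∞ M]

/-- The coordinate vector field in the direction `v` of the preferred chart at `x₀`. -/
noncomputable def coordField (x₀ : M) (v : E) (y : M) : TangentSpace 𝓘(ℝ, E) y :=
  (trivializationAt E (TangentSpace 𝓘(ℝ, E)) x₀).symmL ℝ y v

variable {x₀ y : M}

lemma mem_baseSet_tangent (hy : y ∈ (extChartAt 𝓘(ℝ, E) x₀).source) :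
    y ∈ (trivializationAt E (TangentSpace 𝓘(ℝ, E)) x₀).baseSet := by
  rwa [TangentBundle.trivializationAt_baseSet, ← extChartAt_source 𝓘(ℝ, E)]

lemma continuousLinearMapAt_tangent (hy : y ∈ (extChartAt 𝓘(ℝ, E) x₀).source) :
    (trivializationAt E (TangentSpace 𝓘(ℝ, E)) x₀).continuousLinearMapAt ℝ y =
      mvfderiv 𝓘(ℝ, E) (extChartAt 𝓘(ℝ, E) x₀) y :=
  TangentBundle.continuousLinearMapAt_trivializationAt (by rwa [extChartAt_source] at hy)

lemma mvfderiv_extChartAt_coordField (hy : y ∈ (extChartAt 𝓘(ℝ, E) x₀).source) (v : E) :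
    mvfderiv 𝓘(ℝ, E) (extChartAt 𝓘(ℝ, E) x₀) y (coordField x₀ v y) = v := by
  rw [← continuousLinearMapAt_tangent hy]
  exact (trivializationAt E (TangentSpace 𝓘(ℝ, E)) x₀).continuousLinearMapAt_symmL
    (mem_baseSet_tangent hy) v

lemma coordField_mvfderiv_extChartAt (hy : y ∈ (extChartAt 𝓘(ℝ, E) x₀).source)
    (Y : TangentSpace 𝓘(ℝ, E) y) :
    coordField x₀ (mvfderiv 𝓘(ℝ, E) (extChartAt 𝓘(ℝ, E) x₀) y Y) y = Y := by
  rw [← continuousLinearMapAt_tangent hy]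
  exact (trivializationAt E (TangentSpace 𝓘(ℝ, E)) x₀).symmL_continuousLinearMapAt
    (mem_baseSet_tangent hy) Y

lemma contMDiffOn_coordField (x₀ : M) (v : E) :
    CMDiff[(extChartAt 𝓘(ℝ, E) x₀).source] ∞ (T% (coordField x₀ v)) := by
  set e := trivializationAt E (TangentSpace 𝓘(ℝ, E)) x₀ with he
  have hb : (extChartAt 𝓘(ℝ, E) x₀).source = e.baseSet := by
    rw [he, TangentBundle.trivializationAt_baseSet, ← extChartAt_source 𝓘(ℝ, E)]
  rw [hb, e.contMDiffOn_section_baseSet_iff]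
  refine (contMDiffOn_const (c := v)).congr fun y hy => ?_
  have h := e.continuousLinearMapAt_symmL (R := ℝ) hy v
  rwa [e.continuousLinearMapAt_apply ℝ, e.linearMapAt_apply, if_pos hy] at h

/-- The constant vector field on a vector space. -/
def constField (v : E) (x : E) : TangentSpace 𝓘(ℝ, E) x := v

lemma mlieBracket_constField (v w : E) :
    VectorField.mlieBracket 𝓘(ℝ, E) (constField v) (constField w) = fun _ => 0 := by
  rw [← VectorField.mlieBracketWithin_univ, VectorField.mlieBracketWithin_eq_lieBracketWithin]
  ext x
  change fderivWithin ℝ (fun _ => w) univ x v - fderivWithin ℝ (fun _ => v) univ x w = (0 : E)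
  simp

lemma mpullback_constField (hy : y ∈ (extChartAt 𝓘(ℝ, E) x₀).source) (v : E) :
    VectorField.mpullback 𝓘(ℝ, E) 𝓘(ℝ, E) (extChartAt 𝓘(ℝ, E) x₀) (constField v) y =
      coordField x₀ v y := by
  rw [VectorField.mpullback_apply, (isInvertible_mfderiv_extChartAt hy).inverse_apply_eq]
  exact (mvfderiv_extChartAt_coordField hy v).symm

lemma mlieBracket_coordField [CompleteSpace E] (hy : y ∈ (extChartAt 𝓘(ℝ, E) x₀).source)
    (v w : E) :
    VectorField.mlieBracket 𝓘(ℝ, E) (coordField x₀ v) (coordField x₀ w) y = 0 := by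
  have he : ∀ v : E, coordField x₀ v =ᶠ[𝓝 y]
      VectorField.mpullback 𝓘(ℝ, E) 𝓘(ℝ, E) (extChartAt 𝓘(ℝ, E) x₀) (constField v) := fun v => by
    filter_upwards [(isOpen_extChartAt_source x₀).mem_nhds hy] with z hz
    exact (mpullback_constField hz v).symm
  have hd : ∀ v z : E, MDiffAt (T% (constField v)) z := fun v z =>
    (contMDiffAt_vectorSpace_iff_contDiffAt (n := 1).2 contDiffAt_const).mdifferentiableAt
      one_ne_zero
  have : IsManifold 𝓘(ℝ, E) (minSmoothness ℝ 2) M := by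
    rw [minSmoothness_of_isRCLikeNormedField]
    infer_instance
  rw [(he v).mlieBracket_vectorField_eq (he w), ← VectorField.mpullback_mlieBracket (n := ∞)
    (hd v _) (hd w _) ?_ ?_, mlieBracket_constField, VectorField.mpullback_apply, map_zero]
  · exact contMDiffAt_extChartAt' (by rwa [extChartAt_source] at hy)
  · rw [minSmoothness_of_isRCLikeNormedField]
    exact WithTop.coe_le_coe.2 le_top

end CoordField

/-! ### The connection form in a chart and a trivialization -/

section ConnForm

open Bundle Set Filter

variable {E : Type*} [NormedAddCommGroup E] [NormedSpace ℝ E]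
  {M : Type*} [TopologicalSpace M] [ChartedSpace E M] [IsManifold 𝓘(ℝ, E) ∞ M]
  {F : Type*} [NormedAddCommGroup F] [NormedSpace ℝ F] [FiniteDimensional ℝ F]
  {V : M → Type*} [TopologicalSpace (TotalSpace F V)]
  [∀ x, AddCommGroup (V x)] [∀ x, Module ℝ (V x)] [∀ x : M, TopologicalSpace (V x)]
  [∀ x, IsTopologicalAddGroup (V x)] [∀ x, ContinuousSMul ℝ (V x)]
  [FiberBundle F V] [VectorBundle ℝ F V] [ContMDiffVectorBundle ∞ F V 𝓘(ℝ, E)]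
  {ι : Type*} [Fintype ι] (b : Module.Basis ι ℝ F) (x₀ : M)

variable (E F V) in
/-- The common domain of the preferred chart and of the preferred trivialization at `x₀`. -/
def localDomain : Set M :=
  (extChartAt 𝓘(ℝ, E) x₀).source ∩ (trivializationAt F V x₀).baseSet

lemma isOpen_localDomain : IsOpen (localDomain E F V x₀) :=
  (isOpen_extChartAt_source x₀).inter (trivializationAt F V x₀).open_baseSet

variable (V) in
/-- The local section whose expression in the preferred chart and trivialization at `x₀` is `g`. -/
noncomputable def localSection (g : E → F) (y : M) : V y :=
  ∑ j, b.repr (g (extChartAt 𝓘(ℝ, E) x₀ y)) j • (trivializationAt F V x₀).localFrame b j y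

lemma triv_localFrame {y : M} (hy : y ∈ localDomain E F V x₀) (j : ι) :
    (trivializationAt F V x₀).continuousLinearMapAt ℝ y
      ((trivializationAt F V x₀).localFrame b j y) = b j := by
  rw [(trivializationAt F V x₀).localFrame_apply_of_mem_baseSet b hy.2,
    (trivializationAt F V x₀).continuousLinearMapAt_apply ℝ, Trivialization.linearMapAt_apply,
    if_pos hy.2]
  simp [Trivialization.basisAt, (trivializationAt F V x₀).apply_mk_symm hy.2]

lemma triv_localSection {y : M} (hy : y ∈ localDomain E F V x₀) (g : E → F) :
    (trivializationAt F V x₀).continuousLinearMapAt ℝ y (localSection V b x₀ g y) =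
      g (extChartAt 𝓘(ℝ, E) x₀ y) := by
  simp only [localSection, map_sum, map_smul, triv_localFrame b x₀ hy, b.sum_repr]

lemma eq_localSection {y : M} (hy : y ∈ localDomain E F V x₀) {g : E → F} {p : V y}
    (h : (trivializationAt F V x₀).continuousLinearMapAt ℝ y p = g (extChartAt 𝓘(ℝ, E) x₀ y)) :
    p = localSection V b x₀ g y := by
  rw [← (trivializationAt F V x₀).symmL_continuousLinearMapAt (R := ℝ) hy.2 p, h,
    ← triv_localSection b x₀ hy g, (trivializationAt F V x₀).symmL_continuousLinearMapAt hy.2]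

variable (D : CovariantDerivative 𝓘(ℝ, E) F V)

/-- The derivatives of the sections of the local frame, in the chart and the trivialization. -/
noncomputable def connCoeff (j : ι) (y : M) : E →L[ℝ] F :=
  ContinuousLinearMap.inCoordinates E (TangentSpace 𝓘(ℝ, E)) F V x₀ y x₀ y
    (D ((trivializationAt F V x₀).localFrame b j) y)

/-- The connection form of `D` in the preferred chart and trivialization at `x₀`. -/
noncomputable def connForm (z : E) : E →L[ℝ] F →L[ℝ] F :=
  ∑ j, (ContinuousLinearMap.smulRightL ℝ F F (LinearMap.toContinuousLinearMap (b.coord j))).comp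
    (connCoeff b x₀ D j ((extChartAt 𝓘(ℝ, E) x₀).symm z))

lemma connForm_apply {y : M} (hy : y ∈ localDomain E F V x₀) (v : E) (f : F) :
    connForm b x₀ D (extChartAt 𝓘(ℝ, E) x₀ y) v f =
      ∑ j, b.repr f j • (trivializationAt F V x₀).continuousLinearMapAt ℝ y
        (D ((trivializationAt F V x₀).localFrame b j) y (coordField x₀ v y)) := by
  rw [connForm, (extChartAt 𝓘(ℝ, E) x₀).left_inv hy.1]
  simp [connCoeff, ContinuousLinearMap.inCoordinates]
  rfl

lemma hasMFDerivAt_comp_extChartAt {y : M} (hy : y ∈ (extChartAt 𝓘(ℝ, E) x₀).source) {g : E → F}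
    (hg : DifferentiableAt ℝ g (extChartAt 𝓘(ℝ, E) x₀ y)) (L : F →L[ℝ] ℝ) :
    HasMFDerivAt 𝓘(ℝ, E) 𝓘(ℝ) (fun y => L (g (extChartAt 𝓘(ℝ, E) x₀ y))) y
      ((L.comp (fderiv ℝ g (extChartAt 𝓘(ℝ, E) x₀ y))).comp
        (mvfderiv 𝓘(ℝ, E) (extChartAt 𝓘(ℝ, E) x₀) y)) := by
  have h1 : HasMFDerivAt 𝓘(ℝ, E) 𝓘(ℝ, E) (extChartAt 𝓘(ℝ, E) x₀) y
      (mvfderiv 𝓘(ℝ, E) (extChartAt 𝓘(ℝ, E) x₀) y) :=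
    (mdifferentiableAt_extChartAt (by rwa [extChartAt_source] at hy)).hasMFDerivAt
  exact ((L.hasFDerivAt.comp _ hg.hasFDerivAt).hasMFDerivAt).comp y h1

lemma mdifferentiableAt_localFrame {y : M} (hy : y ∈ localDomain E F V x₀) (j : ι) :
    MDiffAt (T% ((trivializationAt F V x₀).localFrame b j)) y :=
  (contMDiffAt_localFrame_of_mem ∞ _ b j hy.2).mdifferentiableAt (by simp)

lemma mdifferentiableAt_localSection {y : M} (hy : y ∈ localDomain E F V x₀) {g : E → F}
    (hg : DifferentiableAt ℝ g (extChartAt 𝓘(ℝ, E) x₀ y)) :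
    MDiffAt (T% (localSection V b x₀ g)) y :=
  .sum_section fun j _ => MDifferentiableAt.smul_section
    (hasMFDerivAt_comp_extChartAt x₀ hy.1 hg
      (LinearMap.toContinuousLinearMap (b.coord j))).mdifferentiableAt
    (mdifferentiableAt_localFrame b x₀ hy j)

/-- The covariant derivative in a chart and a trivialization. -/
lemma triv_localSection_cov {y : M} (hy : y ∈ localDomain E F V x₀) {g : E → F}
    (hg : DifferentiableAt ℝ g (extChartAt 𝓘(ℝ, E) x₀ y)) (v : E) :
    (trivializationAt F V x₀).continuousLinearMapAt ℝ y
      (D (localSection V b x₀ g) y (coordField x₀ v y)) =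
      fderiv ℝ g (extChartAt 𝓘(ℝ, E) x₀ y) v +
        connForm b x₀ D (extChartAt 𝓘(ℝ, E) x₀ y) v (g (extChartAt 𝓘(ℝ, E) x₀ y)) := by
  have hc := fun j => hasMFDerivAt_comp_extChartAt x₀ hy.1 hg
    (LinearMap.toContinuousLinearMap (b.coord j))
  have hd : ∀ j, mvfderiv 𝓘(ℝ, E) (fun y => b.repr (g (extChartAt 𝓘(ℝ, E) x₀ y)) j) y
      (coordField x₀ v y) = b.repr (fderiv ℝ g (extChartAt 𝓘(ℝ, E) x₀ y) v) j := fun j => by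
    have h1 : mvfderiv 𝓘(ℝ, E) (fun y => b.repr (g (extChartAt 𝓘(ℝ, E) x₀ y)) j) y =
        ((LinearMap.toContinuousLinearMap (b.coord j)).comp
          (fderiv ℝ g (extChartAt 𝓘(ℝ, E) x₀ y))).comp
        (mvfderiv 𝓘(ℝ, E) (extChartAt 𝓘(ℝ, E) x₀) y) := (hc j).mfderiv
    rw [h1, ContinuousLinearMap.comp_apply, mvfderiv_extChartAt_coordField hy.1]
    rfl
  have h1 : D (localSection V b x₀ g) y = ∑ j, (b.repr (g (extChartAt 𝓘(ℝ, E) x₀ y)) j •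
      D ((trivializationAt F V x₀).localFrame b j) y +
      (mvfderiv 𝓘(ℝ, E) (fun y => b.repr (g (extChartAt 𝓘(ℝ, E) x₀ y)) j) y).smulRight
        ((trivializationAt F V x₀).localFrame b j y)) :=
    D.sum_smul Finset.univ (fun j _ => (hc j).mdifferentiableAt)
      (fun j _ => mdifferentiableAt_localFrame b x₀ hy j)
  rw [h1, connForm_apply b x₀ D hy]
  simp only [sum_apply, map_sum, add_apply, smul_apply, map_add, map_smul,
    ContinuousLinearMap.smulRight_apply, hd, triv_localFrame b x₀ hy, Finset.sum_add_distrib,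
    b.sum_repr]
  rw [add_comm]

lemma contMDiffAt_connCoeff [FiniteDimensional ℝ E] [T2Space M]
    (hD : D.ContMDiffCovariantDerivative ∞) {y : M} (hy : y ∈ localDomain E F V x₀) (j : ι) :
    CMDiffAt ∞ (connCoeff b x₀ D j) y := by
  obtain ⟨σ, hσ, hσe⟩ := exists_contMDiff_section_eventuallyEq
    (trivializationAt F V x₀).open_baseSet
    ((trivializationAt F V x₀).contMDiffOn_localFrame_baseSet (I := 𝓘(ℝ, E)) ∞ b j) hy.2
  have h1 := hD.contMDiff.contMDiff (σ := σ) hσ.contMDiffOn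
  rw [contMDiffOn_univ] at h1
  have h2 := ((trivializationAt (E →L[ℝ] F) (fun x => TangentSpace 𝓘(ℝ, E) x →L[ℝ] V x)
    x₀).contMDiffAt_section_iff (x₀ := y) ⟨mem_baseSet_tangent hy.1, hy.2⟩).1 (h1 y)
  refine h2.congr_of_eventuallyEq ?_
  filter_upwards [hσe.eventually_nhds, (isOpen_localDomain x₀).mem_nhds hy] with z hz hzd
  rw [connCoeff, ← D.congr_of_eventuallyEq (mdifferentiableAt_localFrame b x₀ hzd j) hz]
  rfl

lemma contDiffAt_connForm [FiniteDimensional ℝ E] [T2Space M]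
    (hD : D.ContMDiffCovariantDerivative ∞) {y : M}
    (hy : y ∈ localDomain E F V x₀) :
    ContDiffAt ℝ ∞ (connForm b x₀ D) (extChartAt 𝓘(ℝ, E) x₀ y) := by
  refine ContDiffAt.sum fun j _ => ?_
  refine ContDiffAt.clm_comp contDiffAt_const ?_
  rw [← contMDiffAt_iff_contDiffAt]
  have h1 := contMDiffAt_connCoeff b x₀ D hD hy j
  rw [← (extChartAt 𝓘(ℝ, E) x₀).left_inv hy.1] at h1
  refine h1.comp (extChartAt 𝓘(ℝ, E) x₀ y) ?_
  exact (contMDiffOn_extChartAt_symm x₀).contMDiffAt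
    (extChartAt_target_mem_nhds' ((extChartAt 𝓘(ℝ, E) x₀).map_source hy.1))

end ConnForm

/-! ### Local parallel frames -/

namespace FlatVB

open Bundle Set Filter

variable {E : Type w} [NormedAddCommGroup E] [NormedSpace ℝ E] [FiniteDimensional ℝ E]
  {F : Type v} [NormedAddCommGroup F] [NormedSpace ℝ F] [FiniteDimensional ℝ F]
  {M : Type u} [TopologicalSpace M] [T2Space M] [ChartedSpace E M] [IsManifold 𝓘(ℝ, E) ∞ M]

/-- The connection form of a flat connection is flat. -/
lemma FlatConnection.isFlatAt_connForm {W : SmoothBundle E F M} (D : FlatConnection W)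
    {ι : Type*} [Fintype ι] (b : Module.Basis ι ℝ F) {x₀ y : M}
    (hy : y ∈ localDomain E F W.Fiber x₀) :
    FlatForm.IsFlatAt (connForm b x₀ D.cov) (extChartAt 𝓘(ℝ, E) x₀ y) := by
  intro v w f
  set z := extChartAt 𝓘(ℝ, E) x₀ y with hz
  set A := connForm b x₀ D.cov with hA
  have hAd : DifferentiableAt ℝ A z := (contDiffAt_connForm b x₀ D.cov D.smooth hy).differentiableAt (by simp)
  have hopen : IsOpen (localDomain E F W.Fiber x₀) := isOpen_localDomain x₀
  obtain ⟨X, hX, hXe⟩ := exists_contMDiff_section_eventuallyEq (isOpen_extChartAt_source x₀)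
    (contMDiffOn_coordField x₀ v) hy.1
  obtain ⟨Y, hY, hYe⟩ := exists_contMDiff_section_eventuallyEq (isOpen_extChartAt_source x₀)
    (contMDiffOn_coordField x₀ w) hy.1
  have hbr : VectorField.mlieBracket 𝓘(ℝ, E) X Y y = 0 :=
    (EventuallyEq.mlieBracket_vectorField_eq hXe hYe).trans (mlieBracket_coordField hy.1 v w)
  have hbasis : ∀ j, fderiv ℝ A z v w (b j) - fderiv ℝ A z w v (b j)
      + A z v (A z w (b j)) - A z w (A z v (b j)) = 0 := by
    intro j
    obtain ⟨σ, hσ, hσe⟩ := exists_contMDiff_section_eventuallyEq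
      (trivializationAt F W.Fiber x₀).open_baseSet
      ((trivializationAt F W.Fiber x₀).contMDiffOn_localFrame_baseSet (I := 𝓘(ℝ, E)) ∞ b j) hy.2
    have hflat := D.flat X Y σ hX hY hσ y
    have key : ∀ (Z : ∀ x : M, TangentSpace 𝓘(ℝ, E) x) (a v : E),
        (∀ᶠ y' in 𝓝 y, Z y' = coordField x₀ a y') →
        (trivializationAt F W.Fiber x₀).continuousLinearMapAt ℝ y
          (D.cov (fun y' => D.cov σ y' (Z y')) y (coordField x₀ v y)) =
          fderiv ℝ A z v a (b j) + A z v (A z a (b j)) := by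
      intro Z a v hZ
      have hg : DifferentiableAt ℝ (fun z => A z a (b j)) z :=
        (hAd.clm_apply (differentiableAt_const a)).clm_apply (differentiableAt_const (b j))
      have h1 : ∀ᶠ y' in 𝓝 y, D.cov σ y' (Z y') =
          localSection W.Fiber b x₀ (fun z => A z a (b j)) y' := by
        filter_upwards [hσe.eventually_nhds, hZ, hopen.mem_nhds hy] with y' h1 h2 h3
        apply eq_localSection b x₀ h3
        rw [h2, D.cov.congr_of_eventuallyEq (mdifferentiableAt_localFrame b x₀ h3 j) h1, hA,
          connForm_apply b x₀ D.cov h3]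
        classical
        simp [Finsupp.single_apply]
      rw [D.cov.congr_of_eventuallyEq (mdifferentiableAt_localSection b x₀ hy hg) h1,
        triv_localSection_cov b x₀ D.cov hy hg]
      congr 1
      have h2 : HasFDerivAt (fun z => A z a (b j))
          (((fderiv ℝ A z).flip a).flip (b j)) z := by
        have := (hAd.hasFDerivAt.clm_apply (hasFDerivAt_const a z)).clm_apply
          (hasFDerivAt_const (b j) z)
        refine this.congr_fderiv ?_
        ext; simp
      rw [h2.fderiv]
      rfl
    have h3 := congrArg ((trivializationAt F W.Fiber x₀).continuousLinearMapAt ℝ y) hflat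
    rw [hbr, hXe.self_of_nhds, hYe.self_of_nhds] at h3
    simp only [map_sub, map_zero, sub_zero] at h3
    rw [key Y w v hYe, key X v w hXe] at h3
    rw [← h3]; abel
  rw [← b.sum_repr f]
  simp only [map_sum, map_smul, ← Finset.sum_sub_distrib, ← Finset.sum_add_distrib, ← smul_sub,
    ← smul_add, hbasis, smul_zero, Finset.sum_const_zero]

/-- A flat bundle has smooth frames of parallel sections near each point. -/
theorem exists_isParallelFrameOn (A : FlatBundle E F M) {n : ℕ} (b : Module.Basis (Fin n) ℝ F)
    (x₀ : M) : ∃ (h : Fin n → ∀ x, A.bundle.Fiber x) (u : Opens M), x₀ ∈ u ∧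
      IsParallelFrameOn A h u := by
  set φ := extChartAt 𝓘(ℝ, E) x₀ with hφ
  set e := trivializationAt F A.bundle.Fiber x₀ with he
  have hx₀ : x₀ ∈ localDomain E F A.bundle.Fiber x₀ :=
    ⟨mem_extChartAt_source x₀, mem_baseSet_trivializationAt F A.bundle.Fiber x₀⟩
  have hopen : IsOpen (localDomain E F A.bundle.Fiber x₀) := isOpen_localDomain x₀
  have hnhds : ∀ᶠ z in 𝓝 (φ x₀), ∃ y ∈ localDomain E F A.bundle.Fiber x₀, φ y = z := by
    have h1 : ∀ᶠ z in 𝓝 (φ x₀), φ.symm z ∈ localDomain E F A.bundle.Fiber x₀ :=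
      (continuousAt_extChartAt_symm x₀).eventually_mem
        (hopen.mem_nhds (by rwa [extChartAt_to_inv]))
    filter_upwards [h1, extChartAt_target_mem_nhds x₀] with z hz hzt
    exact ⟨_, hz, φ.right_inv hzt⟩
  obtain ⟨r, hr, hσ⟩ := FlatForm.exists_parallel (A := connForm b x₀ A.conn.cov) (z₀ := φ x₀)
    (hnhds.mono fun z ⟨y, hy, hyz⟩ => hyz ▸ contDiffAt_connForm b x₀ A.conn.cov A.conn.smooth hy)
    (hnhds.mono fun z ⟨y, hy, hyz⟩ => hyz ▸ A.conn.isFlatAt_connForm b hy)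
  choose σ hσ0 hσs hσd using fun i => hσ (b i)
  have hφc : ContinuousAt φ x₀ := continuousAt_extChartAt x₀
  have hσc : ContinuousAt (fun y i => σ i (φ y)) x₀ := continuousAt_pi.2 fun i =>
    ContinuousAt.comp (g := σ i) (f := φ)
      (hσd i _ (Metric.mem_ball_self hr)).continuousAt hφc
  have hli : ∀ᶠ y in 𝓝 x₀, LinearIndependent ℝ (fun i => σ i (φ y)) :=
    hσc.eventually_mem (isOpen_setOfPred_linearIndependent.mem_nhds (by
      simpa [hσ0] using! b.linearIndependent))
  have hball : ∀ᶠ y in 𝓝 x₀, φ y ∈ Metric.ball (φ x₀) r :=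
    hφc.eventually_mem (Metric.ball_mem_nhds _ hr)
  obtain ⟨u, hu, huo, hxu⟩ := eventually_nhds_iff.1
    (hli.and (hball.and (hopen.eventually_mem hx₀)))
  refine ⟨fun i => localSection A.bundle.Fiber b x₀ (σ i), ⟨u, huo⟩, hxu, ⟨?_, ?_⟩⟩
  · have hli' : ∀ y ∈ u, LinearIndependent ℝ
        (fun i => localSection A.bundle.Fiber b x₀ (σ i) y) := fun y hy =>
      LinearIndependent.of_comp (e.continuousLinearMapAt ℝ y).toLinearMap (by
        convert (hu y hy).1 using 1
        funext i
        exact triv_localSection b x₀ (hu y hy).2.2 (σ i))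
    refine ⟨fun {y} hy => hli' y hy, fun {y} hy => ?_, fun i y hy => ?_⟩
    · have hfin : Module.finrank ℝ (A.bundle.Fiber y) = Fintype.card (Fin n) := by
        rw [(e.linearEquivAt ℝ y (hu y hy).2.2.2).finrank_eq, Module.finrank_eq_card_basis b]
      have : FiniteDimensional ℝ (A.bundle.Fiber y) :=
        (e.linearEquivAt ℝ y (hu y hy).2.2.2).symm.finiteDimensional
      exact ((hli' y hy).span_eq_top_of_card_eq_finrank' hfin.symm).ge
    · obtain ⟨-, hyb, hyd⟩ := hu y hy
      refine (ContMDiffAt.sum_section fun j _ => ContMDiffAt.smul_section (s := fun y =>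
        (trivializationAt F A.bundle.Fiber x₀).localFrame b j y) ?_
        (contMDiffAt_localFrame_of_mem ∞ _ b j hyd.2)).contMDiffWithinAt
      have h1 : CMDiffAt ∞ φ y := contMDiffAt_extChartAt' (by simpa [hφ] using hyd.1)
      have h2 : ContDiffAt ℝ ∞ (σ i) (φ y) :=
        (hσs i).contDiffAt (Metric.isOpen_ball.mem_nhds hyb)
      exact ((LinearMap.toContinuousLinearMap (b.coord j)).contDiff.contDiffAt.comp _
        h2).contMDiffAt.comp y h1
  · intro i y hy
    obtain ⟨-, hyb, hyd⟩ := hu y hy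
    ext Y
    have hYv := coordField_mvfderiv_extChartAt hyd.1 Y
    rw [← hYv]
    have h1 := triv_localSection_cov b x₀ A.conn.cov hyd (hσd i _ hyb).differentiableAt
      (mvfderiv 𝓘(ℝ, E) φ y Y)
    rw [(hσd i _ hyb).fderiv] at h1
    have h2 := e.symmL_continuousLinearMapAt (R := ℝ) hyd.2
      (A.conn.cov (localSection A.bundle.Fiber b x₀ (σ i)) y
        (coordField x₀ (mvfderiv 𝓘(ℝ, E) φ y Y) y))
    have h3 := h1.trans (neg_add_cancel _)
    rw [← h2, h3, map_zero]
    rfl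

end FlatVB

/-! ### Derivations along vector fields -/

section LieBracket

open Bundle Set Filter

variable {E : Type*} [NormedAddCommGroup E] [NormedSpace ℝ E]
  {M : Type*} [TopologicalSpace M] [ChartedSpace E M] [IsManifold 𝓘(ℝ, E) ∞ M]

lemma contMDiffAt_extChartAt_symm_apply {x₀ y : M} (hy : y ∈ (extChartAt 𝓘(ℝ, E) x₀).source) :
    ContMDiffAt 𝓘(ℝ, E) 𝓘(ℝ, E) ∞ (extChartAt 𝓘(ℝ, E) x₀).symm (extChartAt 𝓘(ℝ, E) x₀ y) :=
  (contMDiffOn_extChartAt_symm x₀).contMDiffAt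
    (extChartAt_target_mem_nhds' ((extChartAt 𝓘(ℝ, E) x₀).map_source hy))

lemma contDiffAt_comp_extChartAt_symm {G : Type*} [NormedAddCommGroup G] [NormedSpace ℝ G]
    {x₀ y : M} (hy : y ∈ (extChartAt 𝓘(ℝ, E) x₀).source) {c : M → G} (hc : CMDiffAt ∞ c y) :
    ContDiffAt ℝ ∞ (c ∘ (extChartAt 𝓘(ℝ, E) x₀).symm) (extChartAt 𝓘(ℝ, E) x₀ y) := by
  rw [← contMDiffAt_iff_contDiffAt]
  rw [← (extChartAt 𝓘(ℝ, E) x₀).left_inv hy] at hc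
  exact hc.comp _ (contMDiffAt_extChartAt_symm_apply hy)

lemma mvfderiv_eq_fderiv_comp {x₀ y : M} (hy : y ∈ (extChartAt 𝓘(ℝ, E) x₀).source) {c : M → ℝ}
    {g : E → ℝ} (hg : DifferentiableAt ℝ g (extChartAt 𝓘(ℝ, E) x₀ y))
    (hc : ∀ᶠ z in 𝓝 y, c z = g (extChartAt 𝓘(ℝ, E) x₀ z)) :
    mvfderiv 𝓘(ℝ, E) c y = (fderiv ℝ g (extChartAt 𝓘(ℝ, E) x₀ y)).comp
      (mvfderiv 𝓘(ℝ, E) (extChartAt 𝓘(ℝ, E) x₀) y) := by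
  have h1 : HasMFDerivAt 𝓘(ℝ, E) 𝓘(ℝ, E) (extChartAt 𝓘(ℝ, E) x₀) y
      (mvfderiv 𝓘(ℝ, E) (extChartAt 𝓘(ℝ, E) x₀) y) :=
    (mdifferentiableAt_extChartAt (by rwa [extChartAt_source] at hy)).hasMFDerivAt
  exact ((hg.hasFDerivAt.hasMFDerivAt.comp y h1).congr_of_eventuallyEq hc).mfderiv

lemma mvfderiv_eq_fderiv {x₀ y : M} (hy : y ∈ (extChartAt 𝓘(ℝ, E) x₀).source) {c : M → ℝ}
    (hc : CMDiffAt ∞ c y) :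
    mvfderiv 𝓘(ℝ, E) c y =
      (fderiv ℝ (c ∘ (extChartAt 𝓘(ℝ, E) x₀).symm) (extChartAt 𝓘(ℝ, E) x₀ y)).comp
        (mvfderiv 𝓘(ℝ, E) (extChartAt 𝓘(ℝ, E) x₀) y) := by
  refine mvfderiv_eq_fderiv_comp hy
    ((contDiffAt_comp_extChartAt_symm hy hc).differentiableAt (by simp)) ?_
  filter_upwards [(isOpen_extChartAt_source x₀).mem_nhds hy] with z hz
  rw [Function.comp_apply, (extChartAt 𝓘(ℝ, E) x₀).left_inv hz]

/-- The expression of a vector field in the preferred chart at `x₀`. -/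
noncomputable def chartField (x₀ : M) (Y : ∀ x : M, TangentSpace 𝓘(ℝ, E) x) (z : E) : E :=
  mvfderiv 𝓘(ℝ, E) (extChartAt 𝓘(ℝ, E) x₀) ((extChartAt 𝓘(ℝ, E) x₀).symm z)
    (Y ((extChartAt 𝓘(ℝ, E) x₀).symm z))

variable {x : M} {X Y : ∀ x : M, TangentSpace 𝓘(ℝ, E) x}

lemma contDiffAt_chartField (hY : CMDiffAt ∞ (T% Y) x) :
    ContDiffAt ℝ ∞ (chartField x Y) (extChartAt 𝓘(ℝ, E) x x) := by
  let e := trivializationAt E (TangentSpace 𝓘(ℝ, E)) x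
  have hx := mem_extChartAt_source (I := 𝓘(ℝ, E)) x
  have h1 : CMDiffAt ∞ (fun y => (e (T% Y y)).2) x :=
    (e.contMDiffAt_section_iff (mem_baseSet_tangent hx)).1 hY
  refine (contDiffAt_comp_extChartAt_symm hx h1).congr_of_eventuallyEq ?_
  filter_upwards [extChartAt_target_mem_nhds x] with z hz
  have hz' := (extChartAt 𝓘(ℝ, E) x).map_target hz
  rw [chartField, ← continuousLinearMapAt_tangent hz']
  change e.continuousLinearMapAt ℝ _ _ = _
  rw [e.continuousLinearMapAt_apply ℝ, e.linearMapAt_apply, if_pos (mem_baseSet_tangent hz')]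
  rfl

lemma eventually_mvfderiv_apply {c : M → ℝ} (hc : ∀ᶠ y in 𝓝 x, CMDiffAt ∞ c y)
    (Y : ∀ x : M, TangentSpace 𝓘(ℝ, E) x) :
    ∀ᶠ y in 𝓝 x, mvfderiv 𝓘(ℝ, E) c y (Y y) =
      (fun z => fderiv ℝ (c ∘ (extChartAt 𝓘(ℝ, E) x).symm) z (chartField x Y z))
        (extChartAt 𝓘(ℝ, E) x y) := by
  filter_upwards [hc, extChartAt_source_mem_nhds (I := 𝓘(ℝ, E)) x] with y hy hys
  have h : chartField x Y (extChartAt 𝓘(ℝ, E) x y) =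
      mvfderiv 𝓘(ℝ, E) (extChartAt 𝓘(ℝ, E) x) y (Y y) := by
    rw [chartField, (extChartAt 𝓘(ℝ, E) x).left_inv hys]
  rw [mvfderiv_eq_fderiv hys hy, ContinuousLinearMap.comp_apply, ← h]

lemma mlieBracket_constField_eq_lieBracket (f g : E → E) (z : E) :
    VectorField.mlieBracket 𝓘(ℝ, E) (fun z => constField (f z) z) (fun z => constField (g z) z) z =
      constField (VectorField.lieBracket ℝ f g z) z := by
  rw [← VectorField.mlieBracketWithin_univ, VectorField.mlieBracketWithin_eq_lieBracketWithin,
    ← VectorField.lieBracketWithin_univ]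
  rfl

lemma mvfderiv_extChartAt_mlieBracket [CompleteSpace E] (hX : CMDiffAt ∞ (T% X) x)
    (hY : CMDiffAt ∞ (T% Y) x) :
    mvfderiv 𝓘(ℝ, E) (extChartAt 𝓘(ℝ, E) x) x (VectorField.mlieBracket 𝓘(ℝ, E) X Y x) =
      VectorField.lieBracket ℝ (chartField x X) (chartField x Y) (extChartAt 𝓘(ℝ, E) x x) := by
  have hx := mem_extChartAt_source (I := 𝓘(ℝ, E)) x
  have hpull : ∀ Y : ∀ x : M, TangentSpace 𝓘(ℝ, E) x, Y =ᶠ[𝓝 x]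
      VectorField.mpullback 𝓘(ℝ, E) 𝓘(ℝ, E) (extChartAt 𝓘(ℝ, E) x)
        (fun z => constField (chartField x Y z) z) := fun Y => by
    filter_upwards [extChartAt_source_mem_nhds (I := 𝓘(ℝ, E)) x] with y hy
    rw [VectorField.mpullback_apply]
    refine ((isInvertible_mfderiv_extChartAt hy).inverse_apply_eq.2 ?_).symm
    change chartField x Y _ = _
    rw [chartField, (extChartAt 𝓘(ℝ, E) x).left_inv hy]
    rfl
  have hd : ∀ {Y : ∀ x : M, TangentSpace 𝓘(ℝ, E) x}, CMDiffAt ∞ (T% Y) x →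
      MDiffAt (T% (fun z : E => constField (chartField x Y z) z)) (extChartAt 𝓘(ℝ, E) x x) :=
    fun hY => (contMDiffAt_vectorSpace_iff_contDiffAt.2
      (contDiffAt_chartField hY)).mdifferentiableAt (by simp)
  have : IsManifold 𝓘(ℝ, E) (minSmoothness ℝ 2) M := by
    rw [minSmoothness_of_isRCLikeNormedField]
    infer_instance
  have h1 : minSmoothness ℝ 2 ≤ (∞ : ℕ∞ω) := by
    rw [minSmoothness_of_isRCLikeNormedField]
    exact WithTop.coe_le_coe.2 le_top
  rw [(hpull X).mlieBracket_vectorField_eq (hpull Y), ← VectorField.mpullback_mlieBracket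
    (hd hX) (hd hY) (contMDiffAt_extChartAt' (mem_chart_source E x)) h1,
    VectorField.mpullback_apply]
  exact ((isInvertible_mfderiv_extChartAt hx).self_apply_inverse _).trans
    (mlieBracket_constField_eq_lieBracket _ _ _)

/-- The Lie bracket of vector fields is their commutator as derivations. -/
lemma mvfderiv_mlieBracket [CompleteSpace E] (hX : CMDiffAt ∞ (T% X) x)
    (hY : CMDiffAt ∞ (T% Y) x) {c : M → ℝ} (hc : ∀ᶠ y in 𝓝 x, CMDiffAt ∞ c y) :
    mvfderiv 𝓘(ℝ, E) (fun y => mvfderiv 𝓘(ℝ, E) c y (Y y)) x (X x)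
      - mvfderiv 𝓘(ℝ, E) (fun y => mvfderiv 𝓘(ℝ, E) c y (X y)) x (Y x)
      - mvfderiv 𝓘(ℝ, E) c x (VectorField.mlieBracket 𝓘(ℝ, E) X Y x) = 0 := by
  have hx := mem_extChartAt_source (I := 𝓘(ℝ, E)) x
  set g := c ∘ (extChartAt 𝓘(ℝ, E) x).symm with hg
  set z := extChartAt 𝓘(ℝ, E) x x with hz
  have hgs : ContDiffAt ℝ ∞ g z := contDiffAt_comp_extChartAt_symm hx hc.self_of_nhds
  have hgd : DifferentiableAt ℝ (fderiv ℝ g) z :=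
    (hgs.fderiv_right (m := 1) (by norm_cast)).differentiableAt one_ne_zero
  have key : ∀ {X Y : ∀ x : M, TangentSpace 𝓘(ℝ, E) x}, CMDiffAt ∞ (T% Y) x →
      mvfderiv 𝓘(ℝ, E) (fun y => mvfderiv 𝓘(ℝ, E) c y (Y y)) x (X x) =
        fderiv ℝ (fderiv ℝ g) z (chartField x X z) (chartField x Y z) +
          fderiv ℝ g z (fderiv ℝ (chartField x Y) z (chartField x X z)) := by
    intro X Y hY
    have hYd : DifferentiableAt ℝ (chartField x Y) z :=
      (contDiffAt_chartField hY).differentiableAt (by simp)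
    rw [mvfderiv_eq_fderiv_comp hx (hgd.clm_apply hYd) (eventually_mvfderiv_apply hc Y), fderiv_clm_apply hgd hYd]
    have h1 : mvfderiv 𝓘(ℝ, E) (extChartAt 𝓘(ℝ, E) x) x (X x) = chartField x X z := by
      rw [chartField, hz, extChartAt_to_inv]
    rw [ContinuousLinearMap.comp_apply, h1]
    simp [add_comm]
  have hsymm : IsSymmSndFDerivAt ℝ g z := hgs.isSymmSndFDerivAt (by
    rw [minSmoothness_of_isRCLikeNormedField]
    exact WithTop.coe_le_coe.2 le_top)
  rw [key hY, key hX, mvfderiv_eq_fderiv hx hc.self_of_nhds, ContinuousLinearMap.comp_apply,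
    mvfderiv_extChartAt_mlieBracket hX hY, VectorField.lieBracket, map_sub,
    hsymm.eq (chartField x X z) (chartField x Y z)]
  abel

end LieBracket

/-! ### Connections determined by local frames -/

section FrameConnection

open Bundle Set Filter

variable {E : Type*} [NormedAddCommGroup E] [NormedSpace ℝ E]
  {M : Type*} [TopologicalSpace M] [ChartedSpace E M] [IsManifold 𝓘(ℝ, E) ∞ M]
  {F : Type*} [NormedAddCommGroup F] [NormedSpace ℝ F]
  {V : M → Type*} [TopologicalSpace (TotalSpace F V)]
  [∀ x, AddCommGroup (V x)] [∀ x, Module ℝ (V x)] [∀ x : M, TopologicalSpace (V x)]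
  [∀ x, IsTopologicalAddGroup (V x)] [∀ x, ContinuousSMul ℝ (V x)]
  [FiberBundle F V] [VectorBundle ℝ F V] [ContMDiffVectorBundle ∞ F V 𝓘(ℝ, E)]

lemma mvfderiv_congr_of_eventuallyEq {c c' : M → ℝ} {x : M} (h : ∀ᶠ y in 𝓝 x, c y = c' y) :
    mvfderiv 𝓘(ℝ, E) c x = mvfderiv 𝓘(ℝ, E) c' x := by
  have h1 : mfderiv 𝓘(ℝ, E) 𝓘(ℝ) c x = mfderiv 𝓘(ℝ, E) 𝓘(ℝ) c' x :=
    Filter.EventuallyEq.mfderiv_eq h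
  ext v
  exact DFunLike.congr_fun h1 v

lemma mvfderiv_sum_mul {ι : Type*} (t : Finset ι) (a : ι → ℝ) {c : ι → M → ℝ} {x : M}
    (hc : ∀ i, MDiffAt (c i) x) :
    MDiffAt (fun y => ∑ i ∈ t, a i * c i y) x ∧
    mvfderiv 𝓘(ℝ, E) (fun y => ∑ i ∈ t, a i * c i y) x =
      ∑ i ∈ t, a i • mvfderiv 𝓘(ℝ, E) (c i) x := by
  classical
  induction t using Finset.induction_on with
  | empty => exact ⟨mdifferentiableAt_const, mvfderiv_const 0⟩
  | insert i t hi ih =>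
    have h2 : (fun y => ∑ j ∈ insert i t, a j * c j y) =
        a i • c i + fun y => ∑ j ∈ t, a j * c j y := funext fun y => Finset.sum_insert hi
    rw [h2, Finset.sum_insert hi, ← ih.2]
    refine ⟨((hc i).const_smul (a i)).add ih.1, ?_⟩
    rw [mvfderiv_add ((hc i).const_smul (a i)) ih.1]
    congr 1
    exact const_smul_mfderiv (hc i) (a i)

lemma contMDiffAt_mvfderiv_smulRight {c : M → ℝ} {x : M} (hc : ∀ᶠ y in 𝓝 x, CMDiffAt ∞ c y)
    {s : Π x, V x} (hs : CMDiffAt ∞ (T% s) x) :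
    ContMDiffAt 𝓘(ℝ, E) (𝓘(ℝ, E).prod 𝓘(ℝ, E →L[ℝ] F)) ∞
      (fun y => (⟨y, (mvfderiv 𝓘(ℝ, E) c y).smulRight (s y)⟩ :
        TotalSpace (E →L[ℝ] F) fun x => TangentSpace 𝓘(ℝ, E) x →L[ℝ] V x)) x := by
  have hx := mem_extChartAt_source (I := 𝓘(ℝ, E)) x
  have hxV := mem_baseSet_trivializationAt F V x
  rw [contMDiffAt_hom_bundle]
  refine ⟨contMDiffAt_id, ?_⟩
  have h1 : CMDiffAt ∞ (fun y => fderiv ℝ (c ∘ (extChartAt 𝓘(ℝ, E) x).symm)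
      (extChartAt 𝓘(ℝ, E) x y)) x :=
    ((contDiffAt_comp_extChartAt_symm hx hc.self_of_nhds).fderiv_right
      (m := ∞) (by simp)).contMDiffAt.comp x contMDiffAt_extChartAt
  have h2 : CMDiffAt ∞ (fun y => (trivializationAt F V x (T% s y)).2) x :=
    ((trivializationAt F V x).contMDiffAt_section_iff hxV).1 hs
  have h3 : CMDiffAt ∞ (fun y => (fderiv ℝ (c ∘ (extChartAt 𝓘(ℝ, E) x).symm)
      (extChartAt 𝓘(ℝ, E) x y)).smulRight (trivializationAt F V x (T% s y)).2) x :=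
    (((ContinuousLinearMap.smulRightL ℝ E F).contMDiff.contMDiffAt (n := ∞)).comp x h1).clm_apply h2
  refine h3.congr_of_eventuallyEq ?_
  filter_upwards [hc, extChartAt_source_mem_nhds (I := 𝓘(ℝ, E)) x,
    (trivializationAt F V x).open_baseSet.mem_nhds hxV] with y hy hys hyV
  ext v
  change (trivializationAt F V x).continuousLinearMapAt ℝ y
    (mvfderiv 𝓘(ℝ, E) c y (coordField x v y) • s y) = _
  rw [mvfderiv_eq_fderiv hys hy, ContinuousLinearMap.comp_apply,
    mvfderiv_extChartAt_coordField hys, map_smul, Trivialization.continuousLinearMapAt_apply,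
    Trivialization.linearMapAt_apply, if_pos hyV]
  rfl

namespace IsLocalFrameOn

variable {ι : Type*} [Fintype ι] {s s' : ι → Π x, V x} {u u' : Set M}
  (hs : IsLocalFrameOn 𝓘(ℝ, E) F ∞ s u) (hs' : IsLocalFrameOn 𝓘(ℝ, E) F ∞ s' u')

lemma coeff_sum_smul {x : M} (hx : x ∈ u) (c : ι → ℝ) (i : ι) :
    hs.coeff i x (∑ j, c j • s j x) = c i := by
  classical
  rw [coeff, dif_pos hx]
  simp only [← hs.toBasisAt_coe hx, map_sum, map_smul, Module.Basis.coord_apply,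
    Module.Basis.repr_self]
  simp [Finsupp.single_apply]

lemma coeff_self [DecidableEq ι] {x : M} (hx : x ∈ u) (i j : ι) :
    hs.coeff i x (s j x) = if j = i then 1 else 0 := by
  have h := (hs.toBasisAt hx).repr_self j
  rw [toBasisAt_coe] at h
  rw [coeff, dif_pos hx, Module.Basis.coord_apply, h, Finsupp.single_apply]

/-- The covariant derivative over `u` for which the frame `s` is parallel. -/
noncomputable def cov (σ : Π x, V x) (x : M) : TangentSpace 𝓘(ℝ, E) x →L[ℝ] V x :=
  ∑ i, (mvfderiv 𝓘(ℝ, E) (fun y => hs.coeff i y (σ y)) x).smulRight (s i x)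

lemma cov_apply (σ : Π x, V x) (x : M) (Y : TangentSpace 𝓘(ℝ, E) x) :
    hs.cov σ x Y = ∑ i, mvfderiv 𝓘(ℝ, E) (fun y => hs.coeff i y (σ y)) x Y • s i x := by
  simp [cov]

lemma isCovariantDerivativeOn_cov (hu : IsOpen u) : IsCovariantDerivativeOn F hs.cov u where
  add {σ σ' x} hσ hσ' hx := by
    have h : ∀ i, mvfderiv 𝓘(ℝ, E) (fun y => hs.coeff i y ((σ + σ') y)) x =
        mvfderiv 𝓘(ℝ, E) (fun y => hs.coeff i y (σ y)) x +
        mvfderiv 𝓘(ℝ, E) (fun y => hs.coeff i y (σ' y)) x := fun i => by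
      rw [← mvfderiv_add (hs.mdifferentiableAt_coeff hu hx hσ i)
        (hs.mdifferentiableAt_coeff hu hx hσ' i)]
      exact mvfderiv_congr_of_eventuallyEq (Eventually.of_forall fun y => map_add _ _ _)
    ext Y
    simp only [cov_apply, h, add_apply, add_smul, Finset.sum_add_distrib]
  leibniz {σ g x} hσ hg hx := by
    have h : ∀ i, mvfderiv 𝓘(ℝ, E) (fun y => hs.coeff i y ((g • σ) y)) x =
        g x • mvfderiv 𝓘(ℝ, E) (fun y => hs.coeff i y (σ y)) x +
        hs.coeff i x (σ x) • mvfderiv 𝓘(ℝ, E) g x := fun i => by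
      rw [← mvfderiv_mul hg (hs.mdifferentiableAt_coeff hu hx hσ i)]
      exact mvfderiv_congr_of_eventuallyEq (Eventually.of_forall fun y => map_smul _ _ _)
    ext Y
    have h2 := hs.coeff_sum_eq σ hx
    simp only [cov_apply, h, add_apply, smul_apply, ContinuousLinearMap.smulRight_apply,
      smul_eq_mul, add_smul, Finset.sum_add_distrib, mul_smul, ← Finset.smul_sum]
    congr 1
    conv_rhs => rw [h2, Finset.smul_sum]
    exact Finset.sum_congr rfl fun i _ => smul_comm _ _ _

/-- Frames with locally constant transitions determine the same covariant derivative. -/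
lemma cov_eq_cov (hu : IsOpen u) (hu' : IsOpen u') {x : M} (hx : x ∈ u) (hx' : x ∈ u')
    (τ : ι → ι → ℝ) (hτ : ∀ᶠ y in 𝓝 x, ∀ i, s i y = ∑ j, τ i j • s' j y)
    {σ : Π x, V x} (hσ : MDiffAt (T% σ) x) : hs.cov σ x = hs'.cov σ x := by
  have hc := fun i => hs.mdifferentiableAt_coeff hu hx hσ i
  have h : ∀ j, mvfderiv 𝓘(ℝ, E) (fun y => hs'.coeff j y (σ y)) x =
      ∑ i, τ i j • mvfderiv 𝓘(ℝ, E) (fun y => hs.coeff i y (σ y)) x := fun j => by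
    have h1 : ∀ᶠ y in 𝓝 x, hs'.coeff j y (σ y) = ∑ i, τ i j * hs.coeff i y (σ y) := by
      filter_upwards [hτ, hu.mem_nhds hx, hu'.mem_nhds hx'] with y hy hyu hyu'
      conv_lhs => rw [hs.coeff_sum_eq σ hyu]
      simp only [map_sum, map_smul]
      refine Finset.sum_congr rfl fun i _ => ?_
      rw [hy, hs'.coeff_sum_smul hyu', smul_eq_mul, mul_comm]
    rw [mvfderiv_congr_of_eventuallyEq h1]
    exact (mvfderiv_sum_mul Finset.univ (fun i => τ i j) hc).2
  ext Y
  rw [cov_apply, cov_apply]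
  simp only [h, sum_apply, smul_apply, Finset.sum_smul, hτ.self_of_nhds, Finset.smul_sum]
  rw [Finset.sum_comm]
  refine Finset.sum_congr rfl fun j _ => Finset.sum_congr rfl fun i _ => ?_
  rw [smul_smul, smul_eq_mul, mul_comm]

lemma cov_self (hu : IsOpen u) (i : ι) {x : M} (hx : x ∈ u) : hs.cov (s i) x = 0 := by
  classical
  ext Y
  rw [cov_apply]
  refine Finset.sum_eq_zero fun j _ => ?_
  have h : ∀ᶠ y in 𝓝 x, hs.coeff j y (s i y) = if i = j then 1 else 0 := by
    filter_upwards [hu.mem_nhds hx] with y hy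
    exact hs.coeff_self hy j i
  rw [mvfderiv_congr_of_eventuallyEq h, mvfderiv_const, zero_apply, zero_smul]

end IsLocalFrameOn

variable {A ι : Type*} [Fintype ι] {h : A → ι → Π x, V x} {u : A → Set M}
  (hf : ∀ α, IsLocalFrameOn 𝓘(ℝ, E) F ∞ (h α) (u α)) (hu : ∀ α, IsOpen (u α))
  (hτ : ∀ α β x, x ∈ u α → x ∈ u β →
    ∃ τ : ι → ι → ℝ, ∀ᶠ y in 𝓝 x, ∀ i, h α i y = ∑ j, τ i j • h β j y)
  (a : M → A) (ha : ∀ x, x ∈ u (a x))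

/-- The covariant derivative for which all frames in a family with locally constant transitions
are parallel. -/
noncomputable def frameCov (hu : ∀ α, IsOpen (u α)) (a : M → A) (ha : ∀ x, x ∈ u (a x)) :
    CovariantDerivative 𝓘(ℝ, E) F V where
  toFun σ x := (hf (a x)).cov σ x
  isCovariantDerivativeOnUniv :=
    { add := fun {_ _ x} h1 h2 _ =>
        ((hf (a x)).isCovariantDerivativeOn_cov (hu _)).add h1 h2 (ha x)
      leibniz := fun {_ _ x} h1 h2 _ =>
        ((hf (a x)).isCovariantDerivativeOn_cov (hu _)).leibniz h1 h2 (ha x) }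

include hτ in
lemma frameCov_eq {α : A} {x : M} (hx : x ∈ u α) {σ : Π x, V x} (hσ : MDiffAt (T% σ) x) :
    frameCov hf hu a ha σ x = (hf α).cov σ x := by
  obtain ⟨τ, h⟩ := hτ (a x) α x (ha x) hx
  exact (hf (a x)).cov_eq_cov (hf α) (hu _) (hu _) (ha x) hx τ h hσ

include hτ in
lemma contMDiffCovariantDerivative_frameCov :
    (frameCov hf hu a ha).ContMDiffCovariantDerivative ∞ where
  contMDiff.contMDiff {σ} hσ := by
    intro x _
    have hσ' : CMDiff ∞ (T% σ) := by simpa [contMDiffOn_univ] using hσ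
    refine ContMDiffAt.contMDiffWithinAt ?_
    have hxu := (hu (a x)).mem_nhds (ha x)
    have h1 := ContMDiffAt.sum_section (I := 𝓘(ℝ, E)) (n := ∞) (F := E →L[ℝ] F)
      (V := fun x => TangentSpace 𝓘(ℝ, E) x →L[ℝ] V x) (x₀ := x) (s := Finset.univ)
      (t := fun i y => (mvfderiv 𝓘(ℝ, E) (fun y => (hf (a x)).coeff i y (σ y)) y).smulRight
        (h (a x) i y)) fun i _ =>
      contMDiffAt_mvfderiv_smulRight (x := x)
      (c := fun y => (hf (a x)).coeff i y (σ y)) (s := h (a x) i)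
      (by filter_upwards [hxu] with y hy using (hf (a x)).contMDiffAt_coeff (hu _) hy (hσ' y) i)
      ((hf (a x)).contMDiffAt (hu _) (ha x) i)
    refine h1.congr_of_eventuallyEq ?_
    filter_upwards [hxu] with y hy
    rw [frameCov_eq hf hu hτ a ha hy ((hσ' y).mdifferentiableAt (by simp))]
    rfl

include hτ in
lemma frameCov_flat [CompleteSpace E] {X Y : ∀ x : M, TangentSpace 𝓘(ℝ, E) x} {σ : Π x, V x}
    (hX : CMDiff ∞ (T% X)) (hY : CMDiff ∞ (T% Y)) (hσ : CMDiff ∞ (T% σ)) (x : M) :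
    frameCov hf hu a ha (fun y => frameCov hf hu a ha σ y (Y y)) x (X x)
      - frameCov hf hu a ha (fun y => frameCov hf hu a ha σ y (X y)) x (Y x)
      - frameCov hf hu a ha σ x (VectorField.mlieBracket 𝓘(ℝ, E) X Y x) = 0 := by
  have hxu := (hu (a x)).mem_nhds (ha x)
  have key : ∀ (Y : ∀ x : M, TangentSpace 𝓘(ℝ, E) x) (Z : TangentSpace 𝓘(ℝ, E) x),
      frameCov hf hu a ha (fun y => frameCov hf hu a ha σ y (Y y)) x Z =
      ∑ i, mvfderiv 𝓘(ℝ, E) (fun y => mvfderiv 𝓘(ℝ, E)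
        (fun z => (hf (a x)).coeff i z (σ z)) y (Y y)) x Z • h (a x) i x := by
    intro Y Z
    refine ((hf (a x)).cov_apply _ _ _).trans (Finset.sum_congr rfl fun i _ => ?_)
    congr 2
    refine mvfderiv_congr_of_eventuallyEq ?_
    filter_upwards [hxu] with y hy
    rw [frameCov_eq hf hu hτ a ha hy ((hσ y).mdifferentiableAt (by simp)),
      IsLocalFrameOn.cov_apply]
    exact (hf (a x)).coeff_sum_smul hy _ i
  have key' : ∀ Z, frameCov hf hu a ha σ x Z = ∑ i, mvfderiv 𝓘(ℝ, E)
      (fun z => (hf (a x)).coeff i z (σ z)) x Z • h (a x) i x :=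
    fun Z => (hf (a x)).cov_apply _ _ _
  rw [key, key, key', ← Finset.sum_sub_distrib, ← Finset.sum_sub_distrib]
  refine Finset.sum_eq_zero fun i _ => ?_
  rw [← sub_smul, ← sub_smul, mvfderiv_mlieBracket (hX x) (hY x), zero_smul]
  filter_upwards [hxu] with y hy using (hf (a x)).contMDiffAt_coeff (hu _) hy (hσ y) i

include hτ in
lemma frameCov_frame {α : A} {x : M} (hx : x ∈ u α) (i : ι) :
    frameCov hf hu a ha (h α i) x = 0 := by
  rw [frameCov_eq hf hu hτ a ha hx (((hf α).contMDiffAt (hu α) hx i).mdifferentiableAt (by simp))]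
  exact (hf α).cov_self (hu α) i hx

end FrameConnection

/-! ### Functions with vanishing derivative and locally constant sections -/

section LocallyConstant

open Filter Set

variable {E : Type*} [NormedAddCommGroup E] [NormedSpace ℝ E]
  {M : Type*} [TopologicalSpace M] [ChartedSpace E M] [IsManifold 𝓘(ℝ, E) ∞ M]

lemma eventually_eq_of_mvfderiv_eq_zero {c : M → ℝ} {x : M} (hc : ∀ᶠ y in 𝓝 x, CMDiffAt ∞ c y)
    (h0 : ∀ᶠ y in 𝓝 x, mvfderiv 𝓘(ℝ, E) c y = 0) : ∀ᶠ y in 𝓝 x, c y = c x := by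
  set z := extChartAt 𝓘(ℝ, E) x x with hz
  set g := c ∘ (extChartAt 𝓘(ℝ, E) x).symm with hg
  have hx := extChartAt_source_mem_nhds (I := 𝓘(ℝ, E)) x
  have h1 : ∀ᶠ y in 𝓝 x, DifferentiableAt ℝ g (extChartAt 𝓘(ℝ, E) x y) ∧
      fderiv ℝ g (extChartAt 𝓘(ℝ, E) x y) = 0 := by
    filter_upwards [hc, h0, hx] with y hy hy0 hys
    refine ⟨(contDiffAt_comp_extChartAt_symm hys hy).differentiableAt (by simp), ?_⟩
    ext v
    have h := DFunLike.congr_fun (mvfderiv_eq_fderiv hys hy) (coordField x v y)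
    rw [hy0, ContinuousLinearMap.comp_apply, mvfderiv_extChartAt_coordField hys] at h
    exact h.symm
  have h2 : ∀ᶠ w in 𝓝 z, DifferentiableAt ℝ g w ∧ fderiv ℝ g w = 0 := by
    have h3 := (continuousAt_extChartAt_symm (I := 𝓘(ℝ, E)) x).eventually
      (by rw [extChartAt_to_inv]; exact h1)
    filter_upwards [h3, extChartAt_target_mem_nhds (I := 𝓘(ℝ, E)) x] with w hw hwt
    rwa [(extChartAt 𝓘(ℝ, E) x).right_inv hwt] at hw
  obtain ⟨r, hr, hball⟩ := Metric.eventually_nhds_iff_ball.1 h2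
  filter_upwards [hx, (continuousAt_extChartAt (I := 𝓘(ℝ, E)) x).eventually
    (Metric.ball_mem_nhds z hr)] with y hys hy
  have h4 := (convex_ball z r).norm_image_sub_le_of_norm_fderiv_le (𝕜 := ℝ) (f := g) (C := 0)
    (fun w hw => (hball w hw).1) (fun w hw => by rw [(hball w hw).2, norm_zero])
    (Metric.mem_ball_self hr) hy
  rw [zero_mul, norm_le_zero_iff, sub_eq_zero] at h4
  rwa [hg, hz, Function.comp_apply, Function.comp_apply, (extChartAt 𝓘(ℝ, E) x).left_inv hys,
    extChartAt_to_inv] at h4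

end LocallyConstant

lemma LocallyConstant.eventually_exists_eq {X G : Type*} [TopologicalSpace X] {W : Opens X}
    (s : LocallyConstant W G) {x : X} (hx : x ∈ W) :
    ∀ᶠ y in 𝓝 x, ∃ hy : y ∈ W, s ⟨y, hy⟩ = s ⟨x, hx⟩ := by
  have h1 : ∀ᶠ y : W in 𝓝 ⟨x, hx⟩, s y = s ⟨x, hx⟩ := s.isLocallyConstant.eventually_eq _
  rw [← W.isOpen.isOpenEmbedding_subtypeVal.map_nhds_eq ⟨x, hx⟩, Filter.eventually_map]
  exact h1.mono fun y hy => ⟨y.2, hy⟩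

lemma IsLocallyConstant.of_eventually_exists_eq {X G : Type*} [TopologicalSpace X] {W : Opens X}
    {s : W → G} (h : ∀ x (hx : x ∈ W), ∀ᶠ y in 𝓝 x, ∀ hy : y ∈ W, s ⟨y, hy⟩ = s ⟨x, hx⟩) :
    IsLocallyConstant s := by
  rw [IsLocallyConstant.iff_eventually_eq]
  rintro ⟨x, hx⟩
  have h1 := h x hx
  rw [← W.isOpen.isOpenEmbedding_subtypeVal.map_nhds_eq ⟨x, hx⟩, Filter.eventually_map] at h1
  exact h1.mono fun y hy => hy y.2

/-! ### Change of frame -/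

/-- The families of vectors `s` and `s'` are related by `s_i = ∑ j, P_ij s'_j`. -/
def IsFrameChange {n : ℕ} {V : Type*} [AddCommGroup V] [Module ℝ V]
    (P : Matrix (Fin n) (Fin n) ℝ) (s s' : Fin n → V) : Prop :=
  ∀ i, s i = ∑ j, P i j • s' j

namespace IsFrameChange

variable {n : ℕ} {V : Type*} [AddCommGroup V] [Module ℝ V] {P Q : Matrix (Fin n) (Fin n) ℝ}
  {s s' s'' : Fin n → V}

lemma refl (s : Fin n → V) : IsFrameChange 1 s s := fun i => by simp [Matrix.one_apply]

lemma trans (h : IsFrameChange P s s') (h' : IsFrameChange Q s' s'') :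
    IsFrameChange (P * Q) s s'' := fun i => by
  simp only [h i, h' _, Finset.smul_sum, smul_smul, Matrix.mul_apply, Finset.sum_smul]
  exact Finset.sum_comm

lemma symm {g : GL (Fin n) ℝ} (h : IsFrameChange g s s') :
    IsFrameChange (g⁻¹ : GL (Fin n) ℝ) s' s := fun i => by
  have h1 : ∀ j, s j = ∑ k, (g : Matrix (Fin n) (Fin n) ℝ) j k • s' k := h
  have h2 : ((g⁻¹ : GL (Fin n) ℝ) : Matrix (Fin n) (Fin n) ℝ) * (g : Matrix (Fin n) (Fin n) ℝ) = 1 :=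
    Units.inv_mul g
  have h3 : IsFrameChange (((g⁻¹ : GL (Fin n) ℝ) : Matrix (Fin n) (Fin n) ℝ) *
      (g : Matrix (Fin n) (Fin n) ℝ)) (fun i => ∑ j,
        ((g⁻¹ : GL (Fin n) ℝ) : Matrix (Fin n) (Fin n) ℝ) i j • s j) s' :=
    trans (fun i => rfl) h
  rw [h2] at h3
  exact (refl s' i).trans (h3 i).symm

lemma unique (hs : LinearIndependent ℝ s') (h : IsFrameChange P s s')
    (h' : IsFrameChange Q s s') : P = Q := by
  ext i j
  have h1 : ∑ j, (P i j - Q i j) • s' j = 0 := by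
    simp only [sub_smul, Finset.sum_sub_distrib, ← h i, ← h' i, sub_self]
  exact sub_eq_zero.1 (Fintype.linearIndependent_iff.1 hs _ h1 j)

lemma map {V' : Type*} [AddCommGroup V'] [Module ℝ V'] (f : V →ₗ[ℝ] V') (h : IsFrameChange P s s') :
    IsFrameChange P (fun i => f (s i)) (fun i => f (s' i)) := fun i => by
  simp [h i]

end IsFrameChange

/-! ### Parallel frames -/

namespace FlatVB

open Bundle Set Filter

variable {E : Type w} [NormedAddCommGroup E] [NormedSpace ℝ E]
  {M : Type u} [TopologicalSpace M] [ChartedSpace E M] [IsManifold 𝓘(ℝ, E) ∞ M]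
  {n : ℕ} {F : Type v} [NormedAddCommGroup F] [NormedSpace ℝ F]

/-- Smoothness of a section at a point. -/
abbrev SmoothBundle.IsSmoothSectionAt (W : SmoothBundle E F M) (s : ∀ x, W.Fiber x) (x : M) : Prop :=
  ContMDiffAt 𝓘(ℝ, E) (𝓘(ℝ, E).prod 𝓘(ℝ, F)) ∞ (fun x => TotalSpace.mk' F x (s x)) x

/-- Differentiability of a section at a point. -/
abbrev SmoothBundle.IsDifferentiableSectionAt (W : SmoothBundle E F M) (s : ∀ x, W.Fiber x)
    (x : M) : Prop :=
  MDifferentiableAt 𝓘(ℝ, E) (𝓘(ℝ, E).prod 𝓘(ℝ, F)) (fun x => TotalSpace.mk' F x (s x)) x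

/-- A bundle with frames related by a cocycle carries a flat connection for which the frames are
parallel. -/
lemma exists_flatConnection [CompleteSpace E] {W : SmoothBundle E F M} {U : Cech.OpenCover M}
    {h : U.Index → Fin n → ∀ x, W.Fiber x}
    (hf : ∀ α, IsLocalFrameOn 𝓘(ℝ, E) F ∞ (h α) (U.set α : Set M))
    {t : Cech.C1 (GL (Fin n) ℝ) U} (ht : IsTransition W U h t) :
    ∃ D : FlatConnection W, ∀ α, IsParallelFrameOn ⟨W, D⟩ (h α) (U.set α) := by
  have hτ : ∀ α β x, x ∈ (U.set α : Set M) → x ∈ (U.set β : Set M) →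
      ∃ τ : Fin n → Fin n → ℝ, ∀ᶠ y in 𝓝 x, ∀ i, h α i y = ∑ j, τ i j • h β j y := by
    intro α β x hα hβ
    refine ⟨(t α β ⟨x, hα, hβ⟩ : Matrix (Fin n) (Fin n) ℝ), ?_⟩
    filter_upwards [(t α β).eventually_exists_eq ⟨hα, hβ⟩] with y ⟨hy, hyt⟩ i
    rw [ht α β y hy.1 hy.2 i, ← hyt]
  have hu : ∀ α, IsOpen (U.set α : Set M) := fun α => (U.set α).isOpen
  choose a ha using U.covers
  exact ⟨⟨frameCov hf hu a ha, contMDiffCovariantDerivative_frameCov hf hu hτ a ha,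
    fun X Y s hX hY hs x => frameCov_flat hf hu hτ a ha hX hY hs x⟩,
    fun α => ⟨hf α, fun i x hx => frameCov_frame hf hu hτ a ha hx i⟩⟩

namespace IsParallelFrameOn

variable {A B : FlatBundle E F M} {s s' : Fin n → ∀ x, A.bundle.Fiber x} {u u' : Opens M}

lemma mdifferentiableAt (hs : IsParallelFrameOn A s u) {x : M} (hx : x ∈ u) (i : Fin n) :
    A.bundle.IsDifferentiableSectionAt (s i) x :=
  (hs.frame.contMDiffAt u.isOpen hx i).mdifferentiableAt (by simp)

lemma mono (hs : IsParallelFrameOn A s u) (h : u' ≤ u) : IsParallelFrameOn A s u' :=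
  ⟨hs.frame.mono h, fun i x hx => hs.parallel i x (h hx)⟩

lemma cov_eq (hs : IsParallelFrameOn A s u) {x : M} (hx : x ∈ u) {σ : ∀ x, A.bundle.Fiber x}
    (hσ : A.bundle.IsDifferentiableSectionAt σ x) : A.conn.cov σ x = ∑ i,
      (mvfderiv 𝓘(ℝ, E) (fun y => hs.frame.coeff i y (σ y)) x).smulRight (s i x) := by
  rw [A.conn.cov.eq_sum_coeff hs.frame u.isOpen hx hσ]
  exact Finset.sum_congr rfl fun i _ => by rw [hs.parallel i x hx, smul_zero, zero_add]

/-- The coefficients of a parallel section with respect to a parallel frame are locally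
constant. -/
lemma eventually_coeff_eq (hs : IsParallelFrameOn A s u) (hs' : IsParallelFrameOn A s' u') {x : M}
    (hx : x ∈ u) (hx' : x ∈ u') (i j : Fin n) :
    ∀ᶠ y in 𝓝 x, hs'.frame.coeff j y (s i y) = hs'.frame.coeff j x (s i x) := by
  have hxu : ∀ᶠ y in 𝓝 x, y ∈ u ⊓ u' := (u ⊓ u').isOpen.mem_nhds ⟨hx, hx'⟩
  refine eventually_eq_of_mvfderiv_eq_zero (E := E)
    (c := fun y => hs'.frame.coeff j y (s i y)) ?_ ?_
  · filter_upwards [hxu] with y hy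
    exact hs'.frame.contMDiffAt_coeff u'.isOpen hy.2 (hs.frame.contMDiffAt u.isOpen hy.1 i) j
  · filter_upwards [hxu] with y hy
    have h := hs.parallel i y hy.1
    rw [hs'.cov_eq hy.2 (hs.mdifferentiableAt hy.1 i)] at h
    ext v
    have h2 := DFunLike.congr_fun h v
    simp only [sum_apply, ContinuousLinearMap.smulRight_apply] at h2
    exact Fintype.linearIndependent_iff.1 (hs'.frame.linearIndependent hy.2) _ h2 j

/-- Parallel frames are related by a locally constant change of frame. -/
lemma exists_isFrameChange (hs : IsParallelFrameOn A s u) (hs' : IsParallelFrameOn A s' u') :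
    ∃ g : Cech.Sections (GL (Fin n) ℝ) (u ⊓ u'), ∀ x (hx : x ∈ u) (hx' : x ∈ u'),
      IsFrameChange (g ⟨x, hx, hx'⟩) (s · x) (s' · x) := by
  let P : ↥(u ⊓ u') → Matrix (Fin n) (Fin n) ℝ := fun x i j => hs'.frame.coeff j x (s i x)
  let Q : ↥(u ⊓ u') → Matrix (Fin n) (Fin n) ℝ := fun x i j => hs.frame.coeff j x (s' i x)
  have hP : ∀ x, IsFrameChange (P x) (s · x) (s' · x) := fun x i =>
    hs'.frame.coeff_sum_eq (s i) x.2.2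
  have hQ : ∀ x, IsFrameChange (Q x) (s' · x) (s · x) := fun x i =>
    hs.frame.coeff_sum_eq (s' i) x.2.1
  have hPQ : ∀ x, P x * Q x = 1 := fun x =>
    IsFrameChange.unique (hs.frame.linearIndependent x.2.1) ((hP x).trans (hQ x)) (.refl _)
  have hQP : ∀ x, Q x * P x = 1 := fun x =>
    IsFrameChange.unique (hs'.frame.linearIndependent x.2.2) ((hQ x).trans (hP x)) (.refl _)
  refine ⟨⟨fun x => ⟨P x, Q x, hPQ x, hQP x⟩, .of_eventually_exists_eq fun x hx => ?_⟩,
    fun x hx hx' => hP ⟨x, hx, hx'⟩⟩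
  have h := eventually_all.2 fun i => eventually_all.2 fun j =>
    eventually_coeff_eq hs hs' hx.1 hx.2 i j
  filter_upwards [h] with y hy hyu
  ext i j
  exact hy i j

/-- A locally constant change of frame preserves parallel frames. -/
lemma of_isFrameChange [FiniteDimensional ℝ F] (hs : IsParallelFrameOn A s u)
    (g : Cech.Sections (GL (Fin n) ℝ) u)
    (hg : ∀ x (hx : x ∈ u), IsFrameChange (g ⟨x, hx⟩) (s' · x) (s · x)) :
    IsParallelFrameOn A s' u := by
  have he : ∀ x (hx : x ∈ u), ∀ i, ∀ᶠ y in 𝓝 x, s' i y = ∑ j,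
      ((g ⟨x, hx⟩ : Matrix (Fin n) (Fin n) ℝ) i j) • s j y := by
    intro x hx i
    filter_upwards [g.eventually_exists_eq hx] with y ⟨hy, hyg⟩
    rw [← hyg]
    exact hg y hy i
  have hgen : ∀ x (hx : x ∈ u), ⊤ ≤ Submodule.span ℝ (Set.range (s' · x)) := by
    intro x hx
    refine (hs.frame.generating hx).trans (Submodule.span_le.2 ?_)
    rintro _ ⟨i, rfl⟩
    have h1 := (hg x hx).symm i
    simp only [SetLike.mem_coe]
    rw [h1]
    exact Submodule.sum_mem _ fun j _ => Submodule.smul_mem _ _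
      (Submodule.subset_span ⟨j, rfl⟩)
  refine ⟨⟨fun {x} hx => ?_, fun {x} hx => hgen x hx, fun i x hx => ?_⟩, fun i x hx => ?_⟩
  · exact linearIndependent_of_top_le_span_of_card_eq_finrank (hgen x hx)
      (Module.finrank_eq_card_basis (hs.frame.toBasisAt hx)).symm
  · have h1 : A.bundle.IsSmoothSectionAt (fun y => ∑ j,
        ((g ⟨x, hx⟩ : Matrix (Fin n) (Fin n) ℝ) i j) • s j y) x :=
      .sum_section fun j _ => (hs.frame.contMDiffAt u.isOpen hx j).const_smul_section
    refine (h1.congr_of_eventuallyEq ?_).contMDiffWithinAt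
    filter_upwards [he x hx i] with y hy
    rw [hy]
  · have h1 : A.bundle.IsDifferentiableSectionAt (fun y => ∑ j,
        ((g ⟨x, hx⟩ : Matrix (Fin n) (Fin n) ℝ) i j) • s j y) x :=
      .sum_section fun j _ => (mdifferentiableAt_const
        (c := (g ⟨x, hx⟩ : Matrix (Fin n) (Fin n) ℝ) i j)).smul_section (hs.mdifferentiableAt hx j)
    rw [A.conn.cov.congr_of_eventuallyEq h1 (he x hx i)]
    refine (A.conn.cov.sum_smul Finset.univ
      (c := fun j _ => (g ⟨x, hx⟩ : Matrix (Fin n) (Fin n) ℝ) i j)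
      (fun j _ => mdifferentiableAt_const) (fun j _ => hs.mdifferentiableAt hx j)).trans ?_
    refine Finset.sum_eq_zero fun j _ => ?_
    rw [hs.parallel j x hx, mvfderiv_const]
    ext v
    simp

/-- Isomorphisms map parallel frames to parallel frames. -/
lemma map_iso [FiniteDimensional ℝ E] [T2Space M] (hs : IsParallelFrameOn A s u) (f : A.Iso B) :
    IsParallelFrameOn B (fun i x => f.toEquiv x (s i x)) u := by
  have hsm : ∀ i, ContMDiffOn 𝓘(ℝ, E) (𝓘(ℝ, E).prod 𝓘(ℝ, F)) ∞
      (fun x => TotalSpace.mk' F x (f.toEquiv x (s i x))) u := fun i =>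
    f.smooth.comp_contMDiffOn (hs.frame.contMDiffOn i)
  refine ⟨⟨fun {x} hx => ?_, fun {x} hx => ?_, hsm⟩, fun i x hx => ?_⟩
  · exact (hs.frame.linearIndependent hx).map' (f.toEquiv x).toLinearMap (f.toEquiv x).ker
  · have h1 := hs.frame.generating hx
    have h2 : Set.range (fun i => f.toEquiv x (s i x)) =
        (f.toEquiv x).toLinearMap '' Set.range (s · x) := by
      rw [← Set.range_comp]
      rfl
    rw [h2, Submodule.span_image, top_le_iff.1 h1, Submodule.map_top, LinearEquiv.range]
  · obtain ⟨σ, hσ, he⟩ := exists_contMDiff_section_eventuallyEq u.isOpen (hs.frame.contMDiffOn i) hx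
    have h1 : B.bundle.IsDifferentiableSectionAt (fun x => f.toEquiv x (s i x)) x :=
      ((hsm i).contMDiffAt (u.isOpen.mem_nhds hx)).mdifferentiableAt (by simp)
    have h2 : ∀ᶠ y in 𝓝 x, f.toEquiv y (σ y) = f.toEquiv y (s i y) :=
      he.mono fun y hy => by rw [hy]
    rw [← B.conn.cov.congr_of_eventuallyEq h1 h2]
    ext Y
    rw [f.map_conn σ hσ x Y, A.conn.cov.congr_of_eventuallyEq (hs.mdifferentiableAt hx i) he,
      hs.parallel i x hx]
    simp

end IsParallelFrameOn

end FlatVB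

/-! ### Equality of classes in the direct limit -/

namespace Cech

variable {X : Type u} [TopologicalSpace X] {G : Type v} [Group G]

lemma Z1.cls_refine {U V : OpenCover X} (a : Z1 G U) (ρ : V.Index → U.Index)
    (hρ : ∀ α, V.set α ≤ U.set (ρ α)) : (a.refine ρ hρ).cls = a.cls := by
  have h : U ≤ V := ⟨ρ, hρ⟩
  have h1 : (⟦⟨U, ⟦a⟧⟩⟧ : H1 X G) = ⟦⟨V, H1Cover.map U V h ⟦a⟧⟩⟧ :=
    DirectLimit.eq_of_le (F := fun U : OpenCover X => H1Cover G U)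
      (f := fun U V h => H1Cover.map U V h) ⟨U, ⟦a⟧⟩ V h
  rw [H1Cover.map_mk h a ρ hρ] at h1
  exact h1.symm

lemma Cohomologous.cls_eq {U : OpenCover X} {a a' : Z1 G U} (h : Cohomologous a a') :
    a.cls = a'.cls := by
  have h1 : (⟦a⟧ : H1Cover G U) = ⟦a'⟧ := Quotient.sound h
  rw [Z1.cls, Z1.cls, h1]

lemma Z1.exists_cls_eq (θ : H1 X G) : ∃ (U : OpenCover X) (a : Z1 G U), a.cls = θ := by
  obtain ⟨U, x, rfl⟩ := DirectLimit.exists_eq_mk _ θ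
  obtain ⟨a, rfl⟩ := Quotient.exists_rep x
  exact ⟨U, a, rfl⟩

lemma Z1.exists_cohomologous_of_cls_eq {U U' : OpenCover X} {a : Z1 G U} {a' : Z1 G U'}
    (h : a.cls = a'.cls) : ∃ (V : OpenCover X) (ρ : V.Index → U.Index) (ρ' : V.Index → U'.Index)
      (hρ : ∀ α, V.set α ≤ U.set (ρ α)) (hρ' : ∀ α, V.set α ≤ U'.set (ρ' α)),
      Cohomologous (a.refine ρ hρ) (a'.refine ρ' hρ') := by
  obtain ⟨V, h1, h2, h3⟩ := Quotient.exact h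
  obtain ⟨ρ, hρ⟩ := id h1
  obtain ⟨ρ', hρ'⟩ := id h2
  refine ⟨V, ρ, ρ', hρ, hρ', ?_⟩
  have h4 : H1Cover.map U V h1 ⟦a⟧ = H1Cover.map U' V h2 ⟦a'⟧ := h3
  rw [H1Cover.map_mk h1 a ρ hρ, H1Cover.map_mk h2 a' ρ' hρ'] at h4
  exact Quotient.exact h4

/-- The common refinement of two open covers. -/
def OpenCover.inter (U V : OpenCover X) : OpenCover X where
  Index := U.Index × V.Index
  set p := U.set p.1 ⊓ V.set p.2
  covers x := by
    obtain ⟨α, hα⟩ := U.covers x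
    obtain ⟨β, hβ⟩ := V.covers x
    exact ⟨(α, β), hα, hβ⟩

end Cech

/-! ### Classification of flat bundles -/

namespace FlatVB

open Bundle Set Filter

variable {E : Type w} [NormedAddCommGroup E] [NormedSpace ℝ E]
  {M : Type u} [TopologicalSpace M] [ChartedSpace E M]
  {n : ℕ} {F : Type v} [NormedAddCommGroup F] [NormedSpace ℝ F]

section Glued

variable [FiniteDimensional ℝ F] (b : Module.Basis (Fin n) ℝ F) {U : Cech.OpenCover M}
  (t : Cech.Z1 (GL (Fin n) ℝ) U)

lemma canonicalFrame_of_mem {α : U.Index} {x : M} (hα : x ∈ U.set α) (i : Fin n) :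
    canonicalFrame (E := E) b t α i x = coordChange b t α ((gluedCore b t).indexAt x) x (b i) :=
  (gluedCore b t).localTriv_symm_apply (i := α) hα (b i)

lemma isTransition_canonicalFrame :
    IsTransition (gluedBundle (E := E) b t) U (canonicalFrame b t) t.1 := by
  intro α β x hα hβ i
  have h1 := (gluedCore b t).coordChange_comp α β ((gluedCore b t).indexAt x) x
    ⟨⟨hα, hβ⟩, (gluedCore b t).mem_baseSet_at x⟩ (b i)
  have h2 : coordChange b t α β x (b i) =
      ∑ j, (t.1 α β ⟨x, hα, hβ⟩ : Matrix (Fin n) (Fin n) ℝ) i j • b j := by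
    rw [coordChange_of_mem b t hα hβ, glAct_basis]
  rw [canonicalFrame_of_mem b t hα]
  refine h1.symm.trans ?_
  change coordChange b t β _ x (coordChange b t α β x (b i)) = _
  rw [h2, map_sum]
  refine Finset.sum_congr rfl fun j _ => ?_
  rw [map_smul, canonicalFrame_of_mem b t hβ]
  rfl

lemma isLocalFrameOn_canonicalFrame [IsManifold 𝓘(ℝ, E) ∞ M] (α : U.Index) :
    IsLocalFrameOn 𝓘(ℝ, E) F ∞ (canonicalFrame (E := E) b t α) (U.set α : Set M) := by
  have : MemTrivializationAtlas ((gluedCore b t).localTriv α) := ⟨⟨α, rfl⟩⟩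
  have h := ((gluedCore b t).localTriv α).isLocalFrameOn_localFrame_baseSet 𝓘(ℝ, E) ∞ b
  refine IsLocalFrameOn.congr h fun i x hx => ?_
  rw [Trivialization.localFrame_apply_of_mem_baseSet _ b hx]
  simp only [Trivialization.basisAt, Module.Basis.map_apply]
  rfl

end Glued

variable [IsManifold 𝓘(ℝ, E) ∞ M]

lemma IsTransition.isFrameChange {W : SmoothBundle E F M} {U : Cech.OpenCover M}
    {h : U.Index → Fin n → ∀ x, W.Fiber x} {t : Cech.C1 (GL (Fin n) ℝ) U}
    (ht : IsTransition W U h t) {α β : U.Index} {x : M} (hα : x ∈ U.set α) (hβ : x ∈ U.set β) :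
    IsFrameChange (t α β ⟨x, hα, hβ⟩) (h α · x) (h β · x) := ht α β x hα hβ

/-- Parallel frames over an open cover are related by a cocycle. -/
lemma exists_isTransition {A : FlatBundle E F M} {U : Cech.OpenCover M}
    {h : U.Index → Fin n → ∀ x, A.bundle.Fiber x}
    (hh : ∀ α, IsParallelFrameOn A (h α) (U.set α)) :
    ∃ t : Cech.Z1 (GL (Fin n) ℝ) U, IsTransition A.bundle U h t.1 := by
  choose t ht using fun α β => (hh α).exists_isFrameChange (hh β)
  refine ⟨⟨t, (Cech.d1_eq_one_iff t).2 fun α β γ x hα hβ hγ => ?_⟩, fun α β x hα hβ => ht α β x hα hβ⟩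
  refine Units.ext ?_
  exact IsFrameChange.unique ((hh γ).frame.linearIndependent hγ)
    ((ht α β x hα hβ).trans (ht β γ x hβ hγ)) (ht α γ x hα hγ)

/-- The flat bundle `A` has parallel frames over the cover `U` with transitions `t`. -/
def HasCocycle (A : FlatBundle E F M) {U : Cech.OpenCover M} (t : Cech.Z1 (GL (Fin n) ℝ) U) :
    Prop :=
  ∃ h : U.Index → Fin n → ∀ x, A.bundle.Fiber x,
    (∀ α, IsParallelFrameOn A (h α) (U.set α)) ∧ IsTransition A.bundle U h t.1

namespace HasCocycle

variable {A B : FlatBundle E F M} {U U' : Cech.OpenCover M} {t : Cech.Z1 (GL (Fin n) ℝ) U}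
  {t' : Cech.Z1 (GL (Fin n) ℝ) U'}

lemma map_iso [FiniteDimensional ℝ E] [T2Space M] (ht : HasCocycle A t) (f : A.Iso B) :
    HasCocycle B t := by
  obtain ⟨h, hh, hht⟩ := ht
  exact ⟨fun α i x => f.toEquiv x (h α i x), fun α => (hh α).map_iso f,
    fun α β x hα hβ => (hht.isFrameChange hα hβ).map (f.toEquiv x).toLinearMap⟩

lemma refine (ht : HasCocycle A t) (ρ : U'.Index → U.Index)
    (hρ : ∀ α, U'.set α ≤ U.set (ρ α)) : HasCocycle A (t.refine ρ hρ) := by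
  obtain ⟨h, hh, hht⟩ := ht
  exact ⟨fun α => h (ρ α), fun α => (hh (ρ α)).mono (hρ α),
    fun α β x hα hβ => hht (ρ α) (ρ β) x (hρ α hα) (hρ β hβ)⟩

open Classical in
lemma of_cohomologous [FiniteDimensional ℝ F] {t t' : Cech.Z1 (GL (Fin n) ℝ) U}
    (ht : HasCocycle A t) (htt' : Cech.Cohomologous t t') : HasCocycle A t' := by
  obtain ⟨h, hh, hht⟩ := ht
  obtain ⟨c, hc⟩ := (Cech.cohomologous_iff _ _).1 htt'
  let k : U.Index → Fin n → ∀ x, A.bundle.Fiber x := fun α i x =>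
    if hx : x ∈ U.set α then
      ∑ j, (((c α ⟨x, hx⟩)⁻¹ : GL (Fin n) ℝ) : Matrix (Fin n) (Fin n) ℝ) i j • h α j x else 0
  have hk : ∀ α x (hx : x ∈ U.set α),
      IsFrameChange ((c α ⟨x, hx⟩)⁻¹ : GL (Fin n) ℝ) (k α · x) (h α · x) :=
    fun α x hx i => dif_pos hx
  refine ⟨k, fun α => (hh α).of_isFrameChange (c α)⁻¹ (hk α), fun α β x hα hβ => ?_⟩
  have h1 := ((hk α x hα).trans (hht.isFrameChange hα hβ)).trans (hk β x hβ).symm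
  rw [inv_inv] at h1
  rw [hc α β x hα hβ]
  exact h1

/-- The class of the cocycle is determined by the flat bundle. -/
lemma cls_eq (ht : HasCocycle A t) (ht' : HasCocycle A t') : t.cls = t'.cls := by
  have h1 : ∀ p : (U.inter U').Index, (U.inter U').set p ≤ U.set p.1 := fun _ => inf_le_left
  have h2 : ∀ p : (U.inter U').Index, (U.inter U').set p ≤ U'.set p.2 := fun _ => inf_le_right
  rw [← t.cls_refine (V := U.inter U') Prod.fst h1, ← t'.cls_refine (V := U.inter U') Prod.snd h2]
  obtain ⟨h, hh, hht⟩ := ht.refine (U' := U.inter U') Prod.fst h1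
  obtain ⟨k, hk, hkt⟩ := ht'.refine (U' := U.inter U') Prod.snd h2
  choose c hc using fun p => (hh p).exists_isFrameChange (hk p)
  refine Cech.Cohomologous.cls_eq ((Cech.cohomologous_iff _ _).2
    ⟨fun p => Cech.res (le_inf le_rfl le_rfl) (c p), fun p q x hp hq => Units.ext ?_⟩)
  refine IsFrameChange.unique ((hk q).frame.linearIndependent hq) (hkt.isFrameChange hp hq) ?_
  exact ((hc p x hp hp).symm.trans (hht.isFrameChange hp hq)).trans (hc q x hq hq)

/-- A fibrewise linear map that maps smooth frames to smooth frames is smooth. -/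
lemma isSmoothBundleMap_of_map_frame [FiniteDimensional ℝ F]
    {h : U.Index → Fin n → ∀ x, A.bundle.Fiber x} {k : U.Index → Fin n → ∀ x, B.bundle.Fiber x}
    (hh : ∀ α, IsParallelFrameOn A (h α) (U.set α)) (hk : ∀ α, IsParallelFrameOn B (k α) (U.set α))
    (f : ∀ x, A.bundle.Fiber x →ₗ[ℝ] B.bundle.Fiber x)
    (hf : ∀ α x, x ∈ U.set α → ∀ i, f x (h α i x) = k α i x) :
    IsSmoothBundleMap A.bundle B.bundle (fun x => f x) := by
  intro p
  obtain ⟨α, hα⟩ := U.covers p.1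
  let e := trivializationAt F B.bundle.Fiber p.1
  have hpe : p.1 ∈ e.baseSet := mem_baseSet_trivializationAt F B.bundle.Fiber p.1
  refine contMDiffAt_totalSpace.2 ⟨contMDiffAt_proj A.bundle.Fiber, ?_⟩
  have hsum : ContMDiffAt (𝓘(ℝ, E).prod 𝓘(ℝ, F)) 𝓘(ℝ, F) ∞
      (fun q : TotalSpace F A.bundle.Fiber => ∑ i, (hh α).frame.coeff i q.1 q.2 •
        (e ⟨q.1, k α i q.1⟩).2) p := by
    refine ContMDiffAt.sum fun i _ => ContMDiffAt.smul
      ((hh α).frame.contMDiffAt_coeff_totalSpace (U.set α).isOpen hα i) ?_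
    have h1 : ContMDiffAt 𝓘(ℝ, E) 𝓘(ℝ, F) ∞ (fun y => (e ⟨y, k α i y⟩).2) p.1 :=
      (e.contMDiffAt_section_iff hpe).1 ((hk α).frame.contMDiffAt (U.set α).isOpen hα i)
    exact h1.comp p (contMDiffAt_proj A.bundle.Fiber)
  refine hsum.congr_of_eventuallyEq ?_
  have hmem : ∀ᶠ q : TotalSpace F A.bundle.Fiber in 𝓝 p, q.1 ∈ (U.set α : Set M) ∩ e.baseSet :=
    (FiberBundle.continuous_proj F A.bundle.Fiber).continuousAt.eventually_mem
      (((U.set α).isOpen.inter e.open_baseSet).mem_nhds ⟨hα, hpe⟩)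
  filter_upwards [hmem] with q hq
  have h2 : q.2 = ∑ i, (hh α).frame.coeff i q.1 q.2 • h α i q.1 := by
    have h3 := ((hh α).frame.toBasisAt hq.1).sum_repr q.2
    simp only [IsLocalFrameOn.toBasisAt_coe] at h3
    rw [← h3]
    refine Finset.sum_congr rfl fun i _ => ?_
    rw [← h3, IsLocalFrameOn.coeff_sum_smul _ hq.1]
  have h4 := congrArg (f q.1) h2
  simp only [map_sum, map_smul, hf α q.1 hq.1] at h4
  have h5 : ∀ v, (e ⟨q.1, v⟩).2 = e.linearEquivAt ℝ q.1 hq.2 v := fun v => rfl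
  change (e ⟨q.1, f q.1 q.2⟩).2 = _
  rw [h4]
  simp only [h5, map_sum, map_smul]

/-- Flat bundles with the same cocycle are isomorphic. -/
lemma nonempty_iso [FiniteDimensional ℝ F] (ht : HasCocycle A t) (ht' : HasCocycle B t) :
    Nonempty (A.Iso B) := by
  obtain ⟨h, hh, hht⟩ := ht
  obtain ⟨k, hk, hkt⟩ := ht'
  choose a ha using U.covers
  let f : ∀ x, A.bundle.Fiber x ≃ₗ[ℝ] B.bundle.Fiber x := fun x =>
    ((hh (a x)).frame.toBasisAt (ha x)).equiv ((hk (a x)).frame.toBasisAt (ha x)) (Equiv.refl _)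
  have hf : ∀ α x, x ∈ U.set α → ∀ i, f x (h α i x) = k α i x := by
    have h0 : ∀ x i, f x (h (a x) i x) = k (a x) i x := fun x i => by
      have h1 := ((hh (a x)).frame.toBasisAt (ha x)).equiv_apply i
        ((hk (a x)).frame.toBasisAt (ha x)) (Equiv.refl _)
      simpa using h1
    intro α x hx i
    have h1 := (hht.isFrameChange hx (ha x)).map (f x).toLinearMap i
    simp only [LinearEquiv.coe_coe, h0] at h1
    rw [h1]
    exact (hkt.isFrameChange hx (ha x) i).symm
  have hfs : ∀ α x, x ∈ U.set α → ∀ i, (f x).symm (k α i x) = h α i x := fun α x hx i => by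
    rw [← hf α x hx i, LinearEquiv.symm_apply_apply]
  exact ⟨{
    toEquiv := f
    smooth := isSmoothBundleMap_of_map_frame hh hk (fun x => (f x).toLinearMap) hf
    smooth_symm := isSmoothBundleMap_of_map_frame hk hh (fun x => (f x).symm.toLinearMap) hfs
    map_conn := fun s hs x Y => by
      have h1 := (hh (a x)).cov_eq (ha x) ((hs x).mdifferentiableAt (by simp))
      have h2 : B.bundle.IsSmoothSectionAt (fun y => f y (s y)) x :=
        (isSmoothBundleMap_of_map_frame hh hk (fun x => (f x).toLinearMap) hf).comp_section hs x
      have h3 := (hk (a x)).cov_eq (ha x) (h2.mdifferentiableAt (by simp))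
      rw [h1, h3]
      simp only [sum_apply, ContinuousLinearMap.smulRight_apply, map_sum, map_smul,
        hf _ x (ha x)]
      refine Finset.sum_congr rfl fun i _ => ?_
      congr 2
      refine mvfderiv_congr_of_eventuallyEq ?_
      filter_upwards [(U.set (a x)).isOpen.mem_nhds (ha x)] with y hy
      have h4 := congrArg (f y) ((hh (a x)).frame.coeff_sum_eq s hy)
      simp only [map_sum, map_smul, hf _ y hy] at h4
      rw [h4, IsLocalFrameOn.coeff_sum_smul _ hy] }⟩

/-- Flat bundles with cocycles in the same class are isomorphic. -/
lemma nonempty_iso_of_cls_eq [FiniteDimensional ℝ F] (ht : HasCocycle A t) (ht' : HasCocycle B t')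
    (h : t.cls = t'.cls) : Nonempty (A.Iso B) := by
  obtain ⟨V, ρ, ρ', hρ, hρ', h1⟩ := Cech.Z1.exists_cohomologous_of_cls_eq h
  exact ((ht.refine ρ hρ).of_cohomologous h1).nonempty_iso (ht'.refine ρ' hρ')

end HasCocycle

lemma exists_parallel_cover [FiniteDimensional ℝ E] [FiniteDimensional ℝ F] [T2Space M]
    (b : Module.Basis (Fin n) ℝ F) (A : FlatBundle E F M) :
    ∃ (U : Cech.OpenCover M) (h : U.Index → Fin n → ∀ x, A.bundle.Fiber x),
      ∀ α, IsParallelFrameOn A (h α) (U.set α) := by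
  choose h u hxu hh using exists_isParallelFrameOn A b
  exact ⟨⟨M, u, fun x => ⟨x, hxu x⟩⟩, h, hh⟩

lemma exists_hasCocycle [FiniteDimensional ℝ E] [FiniteDimensional ℝ F] [T2Space M]
    (b : Module.Basis (Fin n) ℝ F) (A : FlatBundle E F M) :
    ∃ (U : Cech.OpenCover M) (t : Cech.Z1 (GL (Fin n) ℝ) U), HasCocycle A t := by
  obtain ⟨U, h, hh⟩ := exists_parallel_cover b A
  obtain ⟨t, ht⟩ := exists_isTransition hh
  exact ⟨U, t, h, hh, ht⟩

end FlatVB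

open Matrix in
theorem proposition1
    {E : Type w} [NormedAddCommGroup E] [NormedSpace ℝ E] [FiniteDimensional ℝ E]
    {M : Type u} [TopologicalSpace M] [T2Space M] [ChartedSpace E M] [IsManifold 𝓘(ℝ, E) ∞ M]
    {n : ℕ} {F : Type v} [NormedAddCommGroup F] [NormedSpace ℝ F] [FiniteDimensional ℝ F]
    (b : Module.Basis (Fin n) ℝ F) :
    ∃ (Θ : FlatVB.IsoClasses E F M → Cech.H1 M (GL (Fin n) ℝ))
      (Ψ : Cech.H1 M (GL (Fin n) ℝ) → FlatVB.IsoClasses E F M),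
      (∀ A : FlatVB.FlatBundle E F M,
        (∃ (U : Cech.OpenCover M) (h : U.Index → Fin n → ∀ x, A.bundle.Fiber x),
          ∀ α, FlatVB.IsParallelFrameOn A (h α) (U.set α)) ∧
        ∀ (U : Cech.OpenCover M) (h : U.Index → Fin n → ∀ x, A.bundle.Fiber x),
          (∀ α, FlatVB.IsParallelFrameOn A (h α) (U.set α)) →
          ∃ t : Cech.Z1 (GL (Fin n) ℝ) U,
            FlatVB.IsTransition A.bundle U h t.1 ∧ Θ ⟦A⟧ = t.cls) ∧
      (∀ (U : Cech.OpenCover M) (t : Cech.Z1 (GL (Fin n) ℝ) U),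
        FlatVB.IsTransition (FlatVB.gluedBundle (E := E) b t) U (FlatVB.canonicalFrame b t) t.1 ∧
        ∃ D : FlatVB.FlatConnection (FlatVB.gluedBundle (E := E) b t),
          (∀ α, FlatVB.IsParallelFrameOn ⟨FlatVB.gluedBundle b t, D⟩
            (FlatVB.canonicalFrame b t α) (U.set α)) ∧
          Ψ t.cls = ⟦⟨FlatVB.gluedBundle b t, D⟩⟧) ∧
      (∀ θ, Θ (Ψ θ) = θ) ∧
      (∀ ξ, Ψ (Θ ξ) = ξ) := by
  have := FiniteDimensional.complete ℝ E
  have hglue : ∀ (U : Cech.OpenCover M) (t : Cech.Z1 (GL (Fin n) ℝ) U),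
      ∃ D : FlatVB.FlatConnection (FlatVB.gluedBundle (E := E) b t), ∀ α,
        FlatVB.IsParallelFrameOn ⟨FlatVB.gluedBundle b t, D⟩
          (FlatVB.canonicalFrame b t α) (U.set α) := fun U t =>
    FlatVB.exists_flatConnection (FlatVB.isLocalFrameOn_canonicalFrame b t)
      (FlatVB.isTransition_canonicalFrame b t)
  choose D hD using hglue
  have hcocycle : ∀ (U : Cech.OpenCover M) (t : Cech.Z1 (GL (Fin n) ℝ) U),
      FlatVB.HasCocycle (⟨FlatVB.gluedBundle b t, D U t⟩ : FlatVB.FlatBundle E F M) t :=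
    fun U t => ⟨FlatVB.canonicalFrame b t, hD U t, FlatVB.isTransition_canonicalFrame b t⟩
  choose V s hs using fun A : FlatVB.FlatBundle E F M => FlatVB.exists_hasCocycle b A
  choose V' s' hs' using fun θ : Cech.H1 M (GL (Fin n) ℝ) => Cech.Z1.exists_cls_eq θ
  let Θ : FlatVB.IsoClasses E F M → Cech.H1 M (GL (Fin n) ℝ) :=
    Quotient.lift (fun A => (s A).cls) fun A B ⟨f⟩ => ((hs A).map_iso f).cls_eq (hs B)
  let Ψ : Cech.H1 M (GL (Fin n) ℝ) → FlatVB.IsoClasses E F M :=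
    fun θ => ⟦⟨FlatVB.gluedBundle b (s' θ), D _ (s' θ)⟩⟧
  have hΘ : ∀ (A : FlatVB.FlatBundle E F M) {U : Cech.OpenCover M}
      {t : Cech.Z1 (GL (Fin n) ℝ) U}, FlatVB.HasCocycle A t → Θ ⟦A⟧ = t.cls :=
    fun A _ _ h => (hs A).cls_eq h
  have hΨ : ∀ (A : FlatVB.FlatBundle E F M) {U : Cech.OpenCover M}
      {t : Cech.Z1 (GL (Fin n) ℝ) U}, FlatVB.HasCocycle A t → Ψ t.cls = ⟦A⟧ :=
    fun A _ t h => Quotient.sound ((hcocycle _ (s' t.cls)).nonempty_iso_of_cls_eq h (hs' t.cls))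
  refine ⟨Θ, Ψ, fun A => ⟨FlatVB.exists_parallel_cover b A, fun U h hh => ?_⟩, fun U t =>
    ⟨FlatVB.isTransition_canonicalFrame b t, D U t, hD U t, hΨ _ (hcocycle U t)⟩,
    fun θ => (hΘ _ (hcocycle _ (s' θ))).trans (hs' θ), fun ξ => ?_⟩
  · obtain ⟨t, ht⟩ := FlatVB.exists_isTransition hh
    exact ⟨t, ht, hΘ A ⟨h, hh, ht⟩⟩
  · induction ξ using Quotient.ind with
    | _ A => exact hΨ A (hs A)
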